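/- Let $L$ be a positive integer and $\gamma,\mu_1,\dots,\mu_L\in\mathbb C$. Put $a(u)=\sinh(u+\gamma)$, $b(u)=\sinh u$, $c(u)=\sinh\gamma$ (the six-vertex limit of the weights of the elliptic solid-on-solid model, up to normalization), and let $R(u)\in\mathrm{End}(\mathbb C^2\otimes\mathbb C^2)$ be the matrix $$R(u)=\begin{pmatrix}a(u)&0&0&0\\0&b(u)&c(u)&0\\0&c(u)&b(u)&0\\0&0&0&a(u)\end{pmatrix}.$$ Let $B(u)\in\mathrm{End}((\mathbb C^2)^{\otimes L})$ be the upper right block, with respect to the auxiliary factor $0$, of the monodromy matrix $R_{01}(u-\mu_1)R_{02}(u-\mu_2)\cdots R_{0L}(u-\mu_L)$ on $\mathbb C^2\otimes(\mathbb C^2)^{\otimes L}$. Let $$Z(y_1,\dots,y_L)=\left(0\ \ 1\right)^{\otimes L}\,B(y_1)B(y_2)\cdots B(y_L)\,\begin{pmatrix}1\\0\end{pmatrix}^{\otimes L}$$ be the partition function of the six-vertex model with domain-wall boundaries. Let $x_0,x_1,\dots,x_L\in\mathbb C$ satisfy $b(x_i-x_j)\neq0$ for $i\neq j$. Write $X=(x_1,\dots,x_L)$,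 and for $1\le i\le L$ let $X_i^0$ be $X$ with $x_i$ replaced by $x_0$. (1) If $b(x_0-\mu_k)\ne0$ for $1\le k\le L$, then $$Z(X)=\det(W)\prod_{k=1}^L\frac{b(x_0-x_k)}{b(x_0-\mu_k)}\qquad\text{and}\qquad Z(X_i^0)=\det(W_i)\prod_{k=1}^L\frac{b(x_0-x_k)}{b(x_0-\mu_k)}\quad(1\le i\le L),$$ where $W$ and $W_i$ are the $L\times L$ matrices, $1\le\alpha,\beta\le L$, with entries $$W_{\alpha,\beta}=\begin{cases}\displaystyle\prod_{k=1}^La(x_\alpha-\mu_k)-\prod_{k=1}^Lb(x_\alpha-\mu_k)\prod_{\substack{k=0\\k\ne\alpha}}^L\frac{a(x_\alpha-x_k)}{b(x_\alpha-x_k)}&\beta=\alpha,\\[3ex]\displaystyle\frac{c(x_\alpha-x_\beta)}{b(x_\alpha-x_\beta)}\prod_{k=1}^Lb(x_\beta-\mu_k)\prod_{\substack{k=0\\k\ne\alpha,\beta}}^L\frac{a(x_\beta-x_k)}{b(x_\beta-x_k)}&\beta\ne\alpha,\end{cases}$$ $$(W_i)_{\alpha,\beta}=\begin{cases}\displaystyle\frac{c(x_0-x_\alpha)}{b(x_0-x_\alpha)}\prod_{k=1}^Lb(x_0-\mu_k)\prod_{\substack{k=1\\k\neq\alpha}}^L\frac{a(x_0-x_k)}{b(x_0-x_k)}&\beta=i,\\[3ex]W_{\alpha,\beta}&\beta\ne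 i.\end{cases}$$ (2) If $a(x_0-\mu_k)\ne0$ for $1\le k\le L$, then $$Z(X)=\det(V)\prod_{k=1}^L\frac{b(x_k-x_0)}{a(x_0-\mu_k)}\qquad\text{and}\qquad Z(X_i^0)=\det(V_i)\prod_{k=1}^L\frac{b(x_k-x_0)}{a(x_0-\mu_k)}\quad(1\le i\le L),$$ where $V$ and $V_i$ are the $L\times L$ matrices with entries $$V_{\alpha,\beta}=\begin{cases}\displaystyle\prod_{k=1}^Lb(x_\alpha-\mu_k)-\prod_{k=1}^La(x_\alpha-\mu_k)\prod_{\substack{k=0\\k\ne\alpha}}^L\frac{a(x_k-x_\alpha)}{b(x_k-x_\alpha)}&\beta=\alpha,\\[3ex]\displaystyle\frac{c(x_\beta-x_\alpha)}{b(x_\beta-x_\alpha)}\prod_{k=1}^La(x_\beta-\mu_k)\prod_{\substack{k=0\\k\ne\alpha,\beta}}^L\frac{a(x_k-x_\beta)}{b(x_k-x_\beta)}&\beta\ne\alpha,\end{cases}$$ $$(V_i)_{\alpha,\beta}=\begin{cases}\displaystyle\frac{c(x_\alpha-x_0)}{b(x_\alpha-x_0)}\prod_{k=1}^La(x_0-\mu_k)\prod_{\substack{k=1\\k\neq\alpha}}^L\frac{a(x_k-x_0)}{b(x_k-x_0)}&\beta=i,\\[3ex]V_{\alpha,\beta}&\beta\ne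 i.\end{cases}$$ Together (1) and (2) are $2(L+1)$ families of determinantal representations of $Z$. The left-hand sides do not involve $x_0$ in the formulas for $Z(X)$, nor $x_i$ in those for $Z(X_i^0)$; that variable is a free continuous parameter of the family. -/

import Mathlib

namespace SixVertex

noncomputable section

/-- The weight `a(u) = sinh (u + γ)`. -/
def a (γ u : ℂ) : ℂ := Complex.sinh (u + γ)

/-- The weight `b(u) = sinh u`. -/
def b (u : ℂ) : ℂ := Complex.sinh u

/-- The weight `c(u) = sinh γ`, constant in `u`. -/
def c (γ : ℂ) (_u : ℂ) : ℂ := Complex.sinh γ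

/-- The six-vertex R-matrix on `ℂ² ⊗ ℂ²`; the basis vectors `v₁, v₂` have the labels `0, 1`.
In the basis `v₁v₁, v₁v₂, v₂v₁, v₂v₂` it is
`(a 0 0 0; 0 b c 0; 0 c b 0; 0 0 0 a)`. -/
def R (γ u : ℂ) : Matrix (Fin 2 × Fin 2) (Fin 2 × Fin 2) ℂ := fun p q =>
  if p = q then (if p.1 = p.2 then a γ u else b u)
  else if p = q.swap then c γ u
  else 0

/-- `R_{0i}(u)` on `ℂ² ⊗ (ℂ²)^{⊗L}`: the R-matrix acts on the auxiliary factor and on the `i`-th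
quantum factor, and the identity acts on the other factors. -/
def RAux {L : ℕ} (γ u : ℂ) (i : Fin L) :
    Matrix (Fin 2 × (Fin L → Fin 2)) (Fin 2 × (Fin L → Fin 2)) ℂ := fun p q =>
  if ∀ k, k ≠ i → p.2 k = q.2 k then R γ u (p.1, p.2 i) (q.1, q.2 i) else 0

/-- The monodromy matrix `R_{01}(u - μ₁) R_{02}(u - μ₂) ⋯ R_{0L}(u - μ_L)`. -/
def monodromy {L : ℕ} (γ : ℂ) (μ : Fin L → ℂ) (u : ℂ) :
    Matrix (Fin 2 × (Fin L → Fin 2)) (Fin 2 × (Fin L → Fin 2)) ℂ :=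
  (List.ofFn fun i : Fin L => RAux γ (u - μ i) i).prod

/-- The upper right block `B(u)` of the monodromy matrix, with respect to the auxiliary factor. -/
def B {L : ℕ} (γ : ℂ) (μ : Fin L → ℂ) (u : ℂ) :
    Matrix (Fin L → Fin 2) (Fin L → Fin 2) ℂ := fun σ τ =>
  monodromy γ μ u (0, σ) (1, τ)

/-- The partition function with domain-wall boundaries: the matrix element of
`B(y₁) B(y₂) ⋯ B(y_L)` between `(0 1)^{⊗L}` on the left and `(1 0)ᵀ^{⊗L}` on the right. -/
def Z {L : ℕ} (γ : ℂ) (μ : Fin L → ℂ) (y : Fin L → ℂ) : ℂ :=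
  (List.ofFn fun j : Fin L => B γ μ (y j)).prod (fun _ => 1) (fun _ => 0)

/-! In what follows `x : Fin (L + 1) → ℂ` lists `x₀, x₁, …, x_L`. An index `α : Fin L` of a row or
column stands for the label `α.succ` of `x`. -/

open Finset

/-- The set `X = {x₁, …, x_L}`, as a tuple. -/
def X {L : ℕ} (x : Fin (L + 1) → ℂ) : Fin L → ℂ := fun k => x k.succ

/-- The set `X_i^0 = X ∪ {x₀} \ {x_i}`, as a tuple: `x₀` takes the place of `x_i`. -/
def XReplace {L : ℕ} (x : Fin (L + 1) → ℂ) (i : Fin L) : Fin L → ℂ :=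
  Function.update (X x) i (x 0)

/-- The matrix `W` of the reduced type D equations. -/
def W {L : ℕ} (γ : ℂ) (μ : Fin L → ℂ) (x : Fin (L + 1) → ℂ) : Matrix (Fin L) (Fin L) ℂ :=
  fun α β =>
    if β = α then
      (∏ k, a γ (x α.succ - μ k))
        - (∏ k, b (x α.succ - μ k)) *
          ∏ k ∈ univ.filter (fun k => k ≠ α.succ), a γ (x α.succ - x k) / b (x α.succ - x k)
    else
      c γ (x α.succ - x β.succ) / b (x α.succ - x β.succ) * (∏ k, b (x β.succ - μ k)) *
        ∏ k ∈ univ.filter (fun k => k ≠ α.succ ∧ k ≠ β.succ),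
          a γ (x β.succ - x k) / b (x β.succ - x k)

/-- The matrix `W_i`: the `i`-th column of `W` is replaced. -/
def WCol {L : ℕ} (γ : ℂ) (μ : Fin L → ℂ) (x : Fin (L + 1) → ℂ) (i : Fin L) :
    Matrix (Fin L) (Fin L) ℂ :=
  fun α β =>
    if β = i then
      c γ (x 0 - x α.succ) / b (x 0 - x α.succ) * (∏ k, b (x 0 - μ k)) *
        ∏ k ∈ univ.filter (fun k : Fin L => k ≠ α), a γ (x 0 - x k.succ) / b (x 0 - x k.succ)
    else W γ μ x α β

/-- The matrix `V` of the reduced type A equations. -/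
def V {L : ℕ} (γ : ℂ) (μ : Fin L → ℂ) (x : Fin (L + 1) → ℂ) : Matrix (Fin L) (Fin L) ℂ :=
  fun α β =>
    if β = α then
      (∏ k, b (x α.succ - μ k))
        - (∏ k, a γ (x α.succ - μ k)) *
          ∏ k ∈ univ.filter (fun k => k ≠ α.succ), a γ (x k - x α.succ) / b (x k - x α.succ)
    else
      c γ (x β.succ - x α.succ) / b (x β.succ - x α.succ) * (∏ k, a γ (x β.succ - μ k)) *
        ∏ k ∈ univ.filter (fun k => k ≠ α.succ ∧ k ≠ β.succ),
          a γ (x k - x β.succ) / b (x k - x β.succ)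

/-- The matrix `V_i`: the `i`-th column of `V` is replaced. -/
def VCol {L : ℕ} (γ : ℂ) (μ : Fin L → ℂ) (x : Fin (L + 1) → ℂ) (i : Fin L) :
    Matrix (Fin L) (Fin L) ℂ :=
  fun α β =>
    if β = i then
      c γ (x α.succ - x 0) / b (x α.succ - x 0) * (∏ k, a γ (x 0 - μ k)) *
        ∏ k ∈ univ.filter (fun k : Fin L => k ≠ α), a γ (x k.succ - x 0) / b (x k.succ - x 0)
    else V γ μ x α β

end

end SixVertex

/-! The formulas are proved by interpolation in the first inhomogeneity, here `μ 0`. Splitting off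
the first quantum site shows that `Z` on `n + 1` sites is a trigonometric polynomial of degree `n`
in `μ 0`. The operators `B` commute by the Yang–Baxter equation, so any `y j` can be moved to either
end of the product; at `μ 0 = y j` and at `μ 0 = y j + γ` a single term then survives and `Z`
reduces to the partition function on `n` sites (`Z_of_eq`, `Z_of_eq_add`).

Up to a rewriting, `W` and `W_i` are a diagonal matrix minus a trigonometric Cauchy matrix with
scaled columns. Their determinants obey the same two recursions: at one kind of point the Cauchy
part of a column vanishes, at the other the diagonal part does, and an elimination returns a smaller
matrix of the same kind. With the products involving `x₀` included, both sides have degree `n + 1`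
in `μ 0` and agree at `n + 2` points, so induction gives `Z_mul_prod_eq_det`.

The Cauchy form needs `a γ (x i - x j) ≠ 0`. This excludes only countably many `γ`, and continuity
in `γ` removes the restriction. Part (2) is part (1) transported by the crossing symmetry `μ ↦ γ -
μ`, `y ↦ -y` (`Z_crossing`), which exchanges `a` and `b` up to sign. -/

namespace SixVertex

noncomputable section

/-! ### Tensor structure: splitting the first site off the monodromy matrix -/

/-- The operator `A ⊗ M` on `ℂ² ⊗ (ℂ²)^{⊗n}`. -/
def consKron {n : ℕ} (A : Matrix (Fin 2) (Fin 2) ℂ)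
    (M : Matrix (Fin n → Fin 2) (Fin n → Fin 2) ℂ) :
    Matrix (Fin (n + 1) → Fin 2) (Fin (n + 1) → Fin 2) ℂ :=
  fun σ τ => A (σ 0) (τ 0) * M (Fin.tail σ) (Fin.tail τ)

theorem sum_fin_succ_fun {n : ℕ} {E : Type*} [AddCommMonoid E]
    (f : (Fin (n + 1) → Fin 2) → E) :
    ∑ ρ, f ρ = ∑ s : Fin 2, ∑ ρ : Fin n → Fin 2, f (Fin.cons s ρ) := by
  rw [← (Fin.consEquiv (fun _ : Fin (n + 1) => Fin 2)).sum_comp, Fintype.sum_prod_type]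
  rfl

theorem consKron_mul {n : ℕ} (A A' : Matrix (Fin 2) (Fin 2) ℂ)
    (M M' : Matrix (Fin n → Fin 2) (Fin n → Fin 2) ℂ) :
    consKron A M * consKron A' M' = consKron (A * A') (M * M') := by
  ext σ τ
  simp only [Matrix.mul_apply, consKron, sum_fin_succ_fun, Fin.cons_zero, Fin.tail_cons,
    Finset.sum_mul_sum]
  refine Finset.sum_congr rfl fun s _ => Finset.sum_congr rfl fun ρ _ => ?_
  ring

theorem consKron_add_left {n : ℕ} (A A' : Matrix (Fin 2) (Fin 2) ℂ)
    (M : Matrix (Fin n → Fin 2) (Fin n → Fin 2) ℂ) :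
    consKron (A + A') M = consKron A M + consKron A' M := by
  ext σ τ
  simp [consKron, add_mul]

theorem consKron_add_right {n : ℕ} (A : Matrix (Fin 2) (Fin 2) ℂ)
    (M M' : Matrix (Fin n → Fin 2) (Fin n → Fin 2) ℂ) :
    consKron A (M + M') = consKron A M + consKron A M' := by
  ext σ τ
  simp [consKron, mul_add]

theorem consKron_smul_left {n : ℕ} (z : ℂ) (A : Matrix (Fin 2) (Fin 2) ℂ)
    (M : Matrix (Fin n → Fin 2) (Fin n → Fin 2) ℂ) :
    consKron (z • A) M = z • consKron A M := by
  ext σ τ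
  simp [consKron, mul_assoc]

theorem consKron_smul_right {n : ℕ} (z : ℂ) (A : Matrix (Fin 2) (Fin 2) ℂ)
    (M : Matrix (Fin n → Fin 2) (Fin n → Fin 2) ℂ) :
    consKron A (z • M) = z • consKron A M := by
  ext σ τ
  simp [consKron, mul_left_comm]

/-- Adds a quantum factor in front, on which the operator acts as the identity. -/
def addSite {n : ℕ} (M : Matrix (Fin 2 × (Fin n → Fin 2)) (Fin 2 × (Fin n → Fin 2)) ℂ) :
    Matrix (Fin 2 × (Fin (n + 1) → Fin 2)) (Fin 2 × (Fin (n + 1) → Fin 2)) ℂ :=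
  fun p q => if p.2 0 = q.2 0 then M (p.1, Fin.tail p.2) (q.1, Fin.tail q.2) else 0

theorem addSite_one {n : ℕ} :
    addSite (1 : Matrix (Fin 2 × (Fin n → Fin 2)) (Fin 2 × (Fin n → Fin 2)) ℂ) = 1 := by
  ext ⟨i, σ⟩ ⟨j, τ⟩
  have h : σ = τ ↔ σ 0 = τ 0 ∧ Fin.tail σ = Fin.tail τ := by
    simp [funext_iff, Fin.forall_fin_succ, Fin.tail]
  simp only [addSite, Matrix.one_apply, Prod.mk.injEq, h]
  split_ifs <;> tauto

theorem addSite_mul {n : ℕ}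
    (M M' : Matrix (Fin 2 × (Fin n → Fin 2)) (Fin 2 × (Fin n → Fin 2)) ℂ) :
    addSite (M * M') = addSite M * addSite M' := by
  ext ⟨i, σ⟩ ⟨j, τ⟩
  simp only [addSite, Matrix.mul_apply, Fintype.sum_prod_type, sum_fin_succ_fun, Fin.cons_zero,
    Fin.tail_cons, ite_mul, zero_mul, mul_ite, mul_zero]
  split_ifs with h
  · refine Finset.sum_congr rfl fun k _ => ?_
    rw [Finset.sum_eq_single (τ 0)]
    · simp [h]
    · intro s _ hs
      simp [hs]
    · simp
  · symm
    refine Finset.sum_eq_zero fun k _ => Finset.sum_eq_zero fun s _ =>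
      Finset.sum_eq_zero fun ρ _ => ?_
    split_ifs with h1 h2
    · exact absurd (h2.trans h1) h
    · rfl
    · rfl

theorem addSite_list_prod {n : ℕ}
    (l : List (Matrix (Fin 2 × (Fin n → Fin 2)) (Fin 2 × (Fin n → Fin 2)) ℂ)) :
    addSite l.prod = (l.map addSite).prod := by
  induction l with
  | nil => simp [addSite_one]
  | cons M l ih => simp [addSite_mul, ih]

theorem RAux_succ {L : ℕ} (γ u : ℂ) (i : Fin L) : RAux γ u i.succ = addSite (RAux γ u i) := by
  ext ⟨p, σ⟩ ⟨q, τ⟩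
  simp only [RAux, addSite, Fin.forall_fin_succ, Fin.tail, ne_eq, Fin.succ_inj]
  have h : ¬ ((0 : Fin (L + 1)) = i.succ) := (Fin.succ_ne_zero i).symm
  simp only [h, not_false_eq_true, forall_const, ite_and]
  congr

theorem monodromy_succ {L : ℕ} (γ : ℂ) (μ : Fin (L + 1) → ℂ) (u : ℂ) :
    monodromy γ μ u = RAux γ (u - μ 0) 0 * addSite (monodromy γ (Fin.tail μ) u) := by
  simp only [monodromy, List.ofFn_succ, List.prod_cons, addSite_list_prod, List.map_ofFn]
  congr 3
  funext i
  exact RAux_succ _ _ _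

/-- The blocks of the monodromy matrix with respect to the auxiliary factor. -/
def block {L : ℕ} (γ : ℂ) (μ : Fin L → ℂ) (u : ℂ) (i j : Fin 2) :
    Matrix (Fin L → Fin 2) (Fin L → Fin 2) ℂ :=
  fun σ τ => monodromy γ μ u (i, σ) (j, τ)

/-- The blocks of the R-matrix with respect to the first factor. -/
def rBlock (γ u : ℂ) (i j : Fin 2) : Matrix (Fin 2) (Fin 2) ℂ := fun s t => R γ u (i, s) (j, t)

theorem block_zero (γ : ℂ) (μ : Fin 0 → ℂ) (u : ℂ) (i j : Fin 2) :
    block γ μ u i j = if i = j then 1 else 0 := by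
  ext σ τ
  simp only [block, monodromy, List.ofFn_zero, List.prod_nil, Matrix.one_apply, Prod.mk.injEq]
  obtain rfl : σ = τ := Subsingleton.elim _ _
  split_ifs <;> simp_all

theorem block_succ {L : ℕ} (γ : ℂ) (μ : Fin (L + 1) → ℂ) (u : ℂ) (i j : Fin 2) :
    block γ μ u i j =
      ∑ k, consKron (rBlock γ (u - μ 0) i k) (block γ (Fin.tail μ) u k j) := by
  ext σ τ
  simp only [block, monodromy_succ, Matrix.mul_apply, Fintype.sum_prod_type, Matrix.sum_apply,
    consKron, rBlock, addSite, sum_fin_succ_fun, Fin.cons_zero, Fin.tail_cons]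
  refine Finset.sum_congr rfl fun k _ => ?_
  rw [Finset.sum_eq_single (τ 0)]
  · rw [Finset.sum_eq_single (Fin.tail σ)]
    · have h : ∀ l : Fin (L + 1), l ≠ 0 → σ l = (Fin.cons (τ 0) (Fin.tail σ) :
          Fin (L + 1) → Fin 2) l := by
        intro l hl
        obtain ⟨m, rfl⟩ := Fin.exists_succ_eq.2 hl
        simp [Fin.tail]
      simp only [RAux, if_pos h, if_true, Fin.cons_zero]
    · intro ρ _ hρ
      have h : ¬ ∀ l : Fin (L + 1), l ≠ 0 → σ l = (Fin.cons (τ 0) ρ : Fin (L + 1) → Fin 2) l := by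
        intro h
        apply hρ
        funext m
        have := h m.succ (Fin.succ_ne_zero m)
        simpa [Fin.tail] using this.symm
      simp only [RAux, h, if_false, zero_mul]
    · simp
  · intro s _ hs
    simp [hs]
  · simp

/-! ### Yang–Baxter equation and commutation of the operators `B` -/

theorem rBlock_zero_zero (γ u : ℂ) : rBlock γ u 0 0 = !![a γ u, 0; 0, b u] := by
  ext s t; fin_cases s <;> fin_cases t <;> simp [rBlock, R]

theorem rBlock_zero_one (γ u : ℂ) : rBlock γ u 0 1 = !![0, 0; c γ u, 0] := by
  ext s t; fin_cases s <;> fin_cases t <;> simp [rBlock, R]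

theorem rBlock_one_zero (γ u : ℂ) : rBlock γ u 1 0 = !![0, c γ u; 0, 0] := by
  ext s t; fin_cases s <;> fin_cases t <;> simp [rBlock, R]

theorem rBlock_one_one (γ u : ℂ) : rBlock γ u 1 1 = !![b u, 0; 0, a γ u] := by
  ext s t; fin_cases s <;> fin_cases t <;> simp [rBlock, R]

/-- This form of the addition formula serves twice: in the Yang–Baxter equation, and in the
elimination of a row of a Cauchy matrix. -/
theorem a_mul_a (γ u v : ℂ) : a γ u * a γ v = c γ 0 * a γ (u + v) + b u * b v := by
  simp only [a, b, c, Complex.sinh_add, Complex.cosh_add]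
  linear_combination (Complex.sinh u * Complex.sinh v) * Complex.cosh_sq γ

/-- The Yang–Baxter equation. -/
theorem yang_baxter (γ u v : ℂ) (i₁ i₂ m n : Fin 2) :
    ∑ k₁, ∑ k₂, R γ (u - v) (i₁, i₂) (k₁, k₂) • (rBlock γ u k₁ m * rBlock γ v k₂ n) =
      ∑ k₁, ∑ k₂, R γ (u - v) (k₁, k₂) (m, n) • (rBlock γ v i₂ k₂ * rBlock γ u i₁ k₁) := by
  have hu := Complex.cosh_sq u
  -- These three addition formulas account for every matrix entry that does not agree by ring
  -- identities alone.
  have e₁ : a γ (u - v) * b u = b (u - v) * a γ u + c γ 0 * b v := by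
    simp only [a, b, c, Complex.sinh_add, Complex.sinh_sub, Complex.cosh_sub]
    linear_combination (Complex.sinh γ * Complex.sinh v) * hu
  have e₂ : a γ (u - v) * a γ v = c γ 0 * a γ u + b (u - v) * b v := by
    rw [a_mul_a, sub_add_cancel]
  have e₃ : b u * a γ v = b v * a γ u + b (u - v) * c γ 0 := by
    simp only [a, b, c, Complex.sinh_add, Complex.sinh_sub]
    ring
  have key : ∀ i₁ i₂ m n s t : Fin 2,
    (∑ k₁, ∑ k₂, R γ (u - v) (i₁, i₂) (k₁, k₂) • (rBlock γ u k₁ m * rBlock γ v k₂ n)) s t =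
      (∑ k₁, ∑ k₂, R γ (u - v) (k₁, k₂) (m, n) • (rBlock γ v i₂ k₂ * rBlock γ u i₁ k₁)) s t := by
    simp only [Fin.forall_fin_two, Fin.sum_univ_two]
    simp [rBlock_zero_zero, rBlock_zero_one, rBlock_one_zero, rBlock_one_one, R]
    simp only [c] at e₁ e₂ e₃ ⊢
    and_intros
    all_goals first
      | exact Or.inl (mul_comm _ _)
      | linear_combination Complex.sinh γ * e₁
      | linear_combination -Complex.sinh γ * e₁
      | linear_combination Complex.sinh γ * e₂
      | linear_combination -Complex.sinh γ * e₂
      | linear_combination Complex.sinh γ * e₃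
      | linear_combination -Complex.sinh γ * e₃
      | ring
  ext s t
  exact key i₁ i₂ m n s t
/-- The exchange relation of the monodromy matrix. -/
theorem block_exchange {L : ℕ} (γ : ℂ) (μ : Fin L → ℂ) (u v : ℂ) (i₁ i₂ j₁ j₂ : Fin 2) :
    ∑ k₁, ∑ k₂, R γ (u - v) (i₁, i₂) (k₁, k₂) • (block γ μ u k₁ j₁ * block γ μ v k₂ j₂) =
      ∑ k₁, ∑ k₂, R γ (u - v) (k₁, k₂) (j₁, j₂) • (block γ μ v i₂ k₂ * block γ μ u i₁ k₁) := by
  induction L generalizing i₁ i₂ j₁ j₂ with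
  | zero =>
    revert i₁ i₂ j₁ j₂
    simp only [Fin.forall_fin_two, Fin.sum_univ_two]
    simp [block_zero, R]
  | succ L ih =>
    -- The shift by `μ 0` cancels in the difference of the spectral parameters, so the same `R γ (u
    -- - v)` passes through the first site here and through the remaining ones by induction.
    have yb : ∀ m n, _ := yang_baxter γ (u - μ 0) (v - μ 0) i₁ i₂
    simp only [sub_sub_sub_cancel_right] at yb
    calc _ = ∑ m, ∑ n, consKron (∑ k₁, ∑ k₂, R γ (u - v) (i₁, i₂) (k₁, k₂) •
              (rBlock γ (u - μ 0) k₁ m * rBlock γ (v - μ 0) k₂ n))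
              (block γ (Fin.tail μ) u m j₁ * block γ (Fin.tail μ) v n j₂) := by
          simp only [block_succ, Fin.sum_univ_two, add_mul, mul_add, consKron_mul,
            consKron_add_left, consKron_smul_left, smul_add]
          abel
      _ = ∑ k₁, ∑ k₂, consKron (rBlock γ (v - μ 0) i₂ k₂ * rBlock γ (u - μ 0) i₁ k₁)
              (∑ m, ∑ n, R γ (u - v) (k₁, k₂) (m, n) •
                (block γ (Fin.tail μ) u m j₁ * block γ (Fin.tail μ) v n j₂)) := by
          simp only [yb]
          simp only [Fin.sum_univ_two, consKron_add_left, consKron_add_right, consKron_smul_left,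
            consKron_smul_right]
          abel
      _ = _ := by
          simp only [ih]
          simp only [block_succ, Fin.sum_univ_two, add_mul, mul_add, consKron_mul,
            consKron_add_right, consKron_smul_right, smul_add]
          abel

/-- In this component of the exchange relation only the entry `a γ (u - v)` of the R-matrix occurs,
on both sides, and it can be cancelled. -/
theorem commute_B {L : ℕ} (γ : ℂ) (μ : Fin L → ℂ) {u v : ℂ} (h : a γ (u - v) ≠ 0) :
    Commute (B γ μ u) (B γ μ v) := by
  have h' := block_exchange γ μ u v 0 0 1 1
  simp only [Fin.sum_univ_two] at h'
  simp [R] at h'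
  exact (smul_right_injective _ h h')

/-! ### Trigonometric polynomials and interpolation -/

/-- The function is `exp (-n u)` times a polynomial of degree at most `n` in `exp (2 u)`. -/
def TrigPoly (n : ℕ) (f : ℂ → ℂ) : Prop :=
  ∃ p : Polynomial ℂ, p.natDegree ≤ n ∧
    ∀ u, f u = Complex.exp (-(n * u)) * p.eval (Complex.exp (2 * u))

theorem TrigPoly.const (z : ℂ) : TrigPoly 0 fun _ => z :=
  ⟨Polynomial.C z, by simp, by simp⟩

theorem TrigPoly.zero (n : ℕ) : TrigPoly n fun _ => 0 :=
  ⟨0, by simp, by simp⟩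

theorem TrigPoly.add {n : ℕ} {f g : ℂ → ℂ} (hf : TrigPoly n f) (hg : TrigPoly n g) :
    TrigPoly n fun u => f u + g u := by
  obtain ⟨p, hp, hf⟩ := hf
  obtain ⟨q, hq, hg⟩ := hg
  exact ⟨p + q, Polynomial.natDegree_add_le_of_degree_le hp hq, fun u => by
    simp only [hf, hg, Polynomial.eval_add, mul_add]⟩

theorem TrigPoly.mul {n m : ℕ} {f g : ℂ → ℂ} (hf : TrigPoly n f) (hg : TrigPoly m g) :
    TrigPoly (n + m) fun u => f u * g u := by
  obtain ⟨p, hp, hf⟩ := hf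
  obtain ⟨q, hq, hg⟩ := hg
  refine ⟨p * q, Polynomial.natDegree_mul_le.trans (add_le_add hp hq), fun u => ?_⟩
  simp only [hf, hg, Polynomial.eval_mul, Nat.cast_add, add_mul, neg_add, Complex.exp_add]
  ring

theorem TrigPoly.const_mul {n : ℕ} {f : ℂ → ℂ} (z : ℂ) (hf : TrigPoly n f) :
    TrigPoly n fun u => z * f u := by
  simpa using (TrigPoly.const z).mul hf

theorem TrigPoly.sub {n : ℕ} {f g : ℂ → ℂ} (hf : TrigPoly n f) (hg : TrigPoly n g) :
    TrigPoly n fun u => f u - g u := by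
  simpa [sub_eq_add_neg] using hf.add (hg.const_mul (-1))

theorem TrigPoly.sum {n : ℕ} {ι : Type*} (s : Finset ι) {f : ι → ℂ → ℂ}
    (hf : ∀ i ∈ s, TrigPoly n (f i)) : TrigPoly n fun u => ∑ i ∈ s, f i u := by
  classical
  induction s using Finset.induction_on with
  | empty => simpa using TrigPoly.zero n
  | insert i s hi ih =>
    simp only [Finset.sum_insert hi]
    exact (hf i (Finset.mem_insert_self i s)).add
      (ih fun k hk => hf k (Finset.mem_insert_of_mem hk))

theorem TrigPoly.prod {ι : Type*} (s : Finset ι) {f : ι → ℂ → ℂ}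
    (hf : ∀ i ∈ s, TrigPoly 1 (f i)) : TrigPoly s.card fun u => ∏ i ∈ s, f i u := by
  classical
  induction s using Finset.induction_on with
  | empty => simpa using TrigPoly.const 1
  | insert i s hi ih =>
    simp only [Finset.prod_insert hi, Finset.card_insert_of_notMem hi]
    rw [add_comm]
    exact (hf i (Finset.mem_insert_self i s)).mul
      (ih fun k hk => hf k (Finset.mem_insert_of_mem hk))

theorem TrigPoly.list_prod (l : List ℂ) {f : ℂ → ℂ → ℂ}
    (hf : ∀ y, TrigPoly 1 (f y)) : TrigPoly l.length fun u => (l.map fun y => f y u).prod := by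
  induction l with
  | nil => simpa using TrigPoly.const 1
  | cons y l ih =>
    simp only [List.map_cons, List.prod_cons, List.length_cons]
    rw [add_comm]
    exact (hf y).mul ih

theorem trigPoly_b (y : ℂ) : TrigPoly 1 fun u => b (y - u) := by
  refine ⟨Polynomial.C (Complex.exp y / 2) - Polynomial.C (Complex.exp (-y) / 2) * Polynomial.X,
    ?_, fun u => ?_⟩
  · compute_degree
  · simp only [b, Complex.sinh, Polynomial.eval_sub, Polynomial.eval_mul, Polynomial.eval_C,
      Polynomial.eval_X, Nat.cast_one, one_mul, neg_sub, Complex.exp_sub, Complex.exp_neg, two_mul,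
      Complex.exp_add]
    field_simp [Complex.exp_ne_zero]

theorem trigPoly_b_reflect (y γ : ℂ) : TrigPoly 1 fun u => b (y - (γ - u)) := by
  refine ⟨Polynomial.C (Complex.exp (y - γ) / 2) * Polynomial.X -
    Polynomial.C (Complex.exp (γ - y) / 2), ?_, fun u => ?_⟩
  · compute_degree
  · simp only [b, Complex.sinh, Polynomial.eval_sub, Polynomial.eval_mul, Polynomial.eval_C,
      Polynomial.eval_X, Nat.cast_one, one_mul, neg_sub, Complex.exp_sub, Complex.exp_neg, two_mul,
      Complex.exp_add]
    field_simp [Complex.exp_ne_zero]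

/-- Interpolation nodes have to be distinct modulo `π i`, since the polynomial variable is `exp (2
u)`. -/
theorem exp_two_mul_ne {u v : ℂ} (h : b (u - v) ≠ 0) :
    Complex.exp (2 * u) ≠ Complex.exp (2 * v) := by
  contrapose! h
  have h1 : Complex.exp (u - v) = Complex.exp (-(u - v)) := by
    have : u - v = 2 * u + (-(u + v)) := by ring
    rw [this, Complex.exp_add, h, ← Complex.exp_add]
    congr 1
    ring
  rw [b, Complex.sinh, h1, sub_self, zero_div]

/-- Two trigonometric polynomials of degree `n` that agree at `n + 1` nodes are equal. -/
theorem TrigPoly.eq_of_nodes {n : ℕ} {f g : ℂ → ℂ} (hf : TrigPoly n f) (hg : TrigPoly n g)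
    {ι : Type*} [Fintype ι] (hι : n < Fintype.card ι) (z : ι → ℂ)
    (hz : ∀ i k, i ≠ k → b (z i - z k) ≠ 0) (h : ∀ i, f (z i) = g (z i)) : f = g := by
  obtain ⟨p, hp, hfg⟩ := hf.sub hg
  have hp0 : p = 0 := by
    refine Polynomial.eq_zero_of_natDegree_lt_card_of_eval_eq_zero p
      (f := fun i => Complex.exp (2 * z i)) ?_ ?_ (hp.trans_lt hι)
    · intro i k hik
      by_contra hne
      exact exp_two_mul_ne (hz i k hne) hik
    · intro i
      have := hfg (z i)
      simp only [h i, sub_self] at this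
      exact (mul_eq_zero.1 this.symm).resolve_left (Complex.exp_ne_zero _)
  funext u
  have := hfg u
  rw [hp0] at this
  simpa [sub_eq_zero] using this

/-! ### Recursions for the partition function -/

/-- The product `B(u₁) B(u₂) ⋯`. -/
def bProd {L : ℕ} (γ : ℂ) (μ : Fin L → ℂ) (l : List ℂ) :
    Matrix (Fin L → Fin 2) (Fin L → Fin 2) ℂ := (l.map (B γ μ)).prod

theorem Z_eq_bProd {L : ℕ} (γ : ℂ) (μ y : Fin L → ℂ) :
    Z γ μ y = bProd γ μ (List.ofFn y) (fun _ => 1) (fun _ => 0) := by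
  rw [Z, bProd, List.map_ofFn]
  rfl

/-- The block of an operator with prescribed states of the first quantum factor. -/
def siteBlock {n : ℕ} (M : Matrix (Fin (n + 1) → Fin 2) (Fin (n + 1) → Fin 2) ℂ) (s t : Fin 2) :
    Matrix (Fin n → Fin 2) (Fin n → Fin 2) ℂ :=
  fun σ τ => M (Fin.cons s σ) (Fin.cons t τ)

theorem siteBlock_mul {n : ℕ} (M M' : Matrix (Fin (n + 1) → Fin 2) (Fin (n + 1) → Fin 2) ℂ)
    (s t : Fin 2) :
    siteBlock (M * M') s t =
      siteBlock M s 0 * siteBlock M' 0 t + siteBlock M s 1 * siteBlock M' 1 t := by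
  ext σ τ
  simp [siteBlock, Matrix.mul_apply, sum_fin_succ_fun]

theorem siteBlock_one {n : ℕ} (s t : Fin 2) :
    siteBlock (1 : Matrix (Fin (n + 1) → Fin 2) (Fin (n + 1) → Fin 2) ℂ) s t =
      if s = t then 1 else 0 := by
  ext σ τ
  by_cases h : s = t <;> simp [siteBlock, Matrix.one_apply, Fin.cons_inj, h]

theorem siteBlock_block {L : ℕ} (γ : ℂ) (μ : Fin (L + 1) → ℂ) (u : ℂ) (i j s t : Fin 2) :
    siteBlock (block γ μ u i j) s t =
      ∑ k, R γ (u - μ 0) (i, s) (k, t) • block γ (Fin.tail μ) u k j := by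
  ext σ τ
  simp [siteBlock, block_succ, consKron, rBlock, Matrix.sum_apply]

theorem B_eq_block {L : ℕ} (γ : ℂ) (μ : Fin L → ℂ) (u : ℂ) : B γ μ u = block γ μ u 0 1 := rfl

section
variable {L : ℕ} (γ : ℂ) (μ : Fin (L + 1) → ℂ)

theorem siteBlock_B_zero_zero (u : ℂ) :
    siteBlock (B γ μ u) 0 0 = a γ (u - μ 0) • B γ (Fin.tail μ) u := by
  simp [B_eq_block, siteBlock_block, R]

/-- By the ice rule of the R-matrix, `B` is triangular with respect to the first site. Hence in a
product of `B`s the diagonal blocks multiply, and each term of the lower left block contains exactly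
one off-diagonal factor. -/
theorem siteBlock_B_zero_one (u : ℂ) : siteBlock (B γ μ u) 0 1 = 0 := by
  simp [B_eq_block, siteBlock_block, R]

theorem siteBlock_B_one_zero (u : ℂ) :
    siteBlock (B γ μ u) 1 0 = c γ 0 • block γ (Fin.tail μ) u 1 1 := by
  simp [B_eq_block, siteBlock_block, R, c]

theorem siteBlock_B_one_one (u : ℂ) :
    siteBlock (B γ μ u) 1 1 = b (u - μ 0) • B γ (Fin.tail μ) u := by
  simp [B_eq_block, siteBlock_block, R]

theorem siteBlock_bProd_zero_one (l : List ℂ) : siteBlock (bProd γ μ l) 0 1 = 0 := by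
  induction l with
  | nil => simp [bProd, siteBlock_one]
  | cons u l ih =>
    simp only [bProd, List.map_cons, List.prod_cons] at ih ⊢
    simp [siteBlock_mul, ih, siteBlock_B_zero_one]

theorem siteBlock_bProd_zero_zero (l : List ℂ) :
    siteBlock (bProd γ μ l) 0 0 =
      (l.map fun u => a γ (u - μ 0)).prod • bProd γ (Fin.tail μ) l := by
  induction l with
  | nil => simp [bProd, siteBlock_one]
  | cons u l ih =>
    simp only [bProd, List.map_cons, List.prod_cons] at ih ⊢
    simp [siteBlock_mul, ih, siteBlock_B_zero_one, siteBlock_B_zero_zero, smul_smul, mul_comm]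

theorem siteBlock_bProd_one_one (l : List ℂ) :
    siteBlock (bProd γ μ l) 1 1 =
      (l.map fun u => b (u - μ 0)).prod • bProd γ (Fin.tail μ) l := by
  induction l with
  | nil => simp [bProd, siteBlock_one]
  | cons u l ih =>
    have h01 := siteBlock_bProd_zero_one γ μ l
    simp only [bProd, List.map_cons, List.prod_cons] at ih h01 ⊢
    simp [siteBlock_mul, ih, h01, siteBlock_B_one_one, smul_smul, mul_comm]

/-- The second term drops out at `μ 0 = u`, which is the source of `Z_of_eq`. -/
theorem siteBlock_bProd_cons (u : ℂ) (l : List ℂ) :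
    siteBlock (bProd γ μ (u :: l)) 1 0 =
      (c γ 0 * (l.map fun u => a γ (u - μ 0)).prod) •
          (block γ (Fin.tail μ) u 1 1 * bProd γ (Fin.tail μ) l) +
        b (u - μ 0) • (B γ (Fin.tail μ) u * siteBlock (bProd γ μ l) 1 0) := by
  have h : bProd γ μ (u :: l) = B γ μ u * bProd γ μ l := by simp [bProd]
  rw [h, siteBlock_mul, siteBlock_B_one_zero, siteBlock_B_one_one, siteBlock_bProd_zero_zero]
  simp [smul_smul, mul_comm]

/-- The first term drops out at `μ 0 = u + γ`, which is the source of `Z_of_eq_add`. -/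
theorem siteBlock_bProd_append (u : ℂ) (l : List ℂ) :
    siteBlock (bProd γ μ (l ++ [u])) 1 0 =
      a γ (u - μ 0) • (siteBlock (bProd γ μ l) 1 0 * B γ (Fin.tail μ) u) +
      (c γ 0 * (l.map fun u => b (u - μ 0)).prod) •
          (bProd γ (Fin.tail μ) l * block γ (Fin.tail μ) u 1 1) := by
  have h : bProd γ μ (l ++ [u]) = bProd γ μ l * B γ μ u := by simp [bProd]
  rw [h, siteBlock_mul, siteBlock_B_one_zero, siteBlock_B_zero_zero, siteBlock_bProd_one_one]
  simp [smul_smul]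

end

/-- The left vector `(0 1)^{⊗L}` is an eigenvector of `D(u)`. -/
theorem block_one_one_left {L : ℕ} (γ : ℂ) (μ : Fin L → ℂ) (u : ℂ) (τ : Fin L → Fin 2) :
    block γ μ u 1 1 (fun _ => 1) τ =
      (∏ l, a γ (u - μ l)) * (1 : Matrix (Fin L → Fin 2) (Fin L → Fin 2) ℂ) (fun _ => 1) τ := by
  induction L with
  | zero => simp [block_zero]
  | succ L ih =>
    have h1 : (fun _ => 1 : Fin (L + 1) → Fin 2) = Fin.cons 1 (fun _ => 1) := by
      funext l; cases l using Fin.cases <;> rfl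
    obtain ⟨t, τ, rfl⟩ : ∃ t τ', τ = Fin.cons t τ' :=
      ⟨τ 0, Fin.tail τ, (Fin.cons_self_tail τ).symm⟩
    have hs := congrFun₂ (siteBlock_block γ μ u 1 1 1 t) (fun _ => 1) τ
    have ho := congrFun₂ (siteBlock_one (n := L) 1 t) (fun _ => 1) τ
    simp only [siteBlock] at hs ho
    rw [h1, hs, ho, Fin.prod_univ_succ]
    simp only [Fin.sum_univ_two, Matrix.add_apply, Matrix.smul_apply, ih]
    fin_cases t <;> simp [R, Fin.tail, mul_assoc]

/-- The right vector `(1 0)^{⊗L}` is an eigenvector of `D(u)`. -/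
theorem block_one_one_right {L : ℕ} (γ : ℂ) (μ : Fin L → ℂ) (u : ℂ) (σ : Fin L → Fin 2) :
    block γ μ u 1 1 σ (fun _ => 0) =
      (∏ l, b (u - μ l)) * (1 : Matrix (Fin L → Fin 2) (Fin L → Fin 2) ℂ) σ (fun _ => 0) := by
  induction L with
  | zero => simp [block_zero]
  | succ L ih =>
    have h1 : (fun _ => 0 : Fin (L + 1) → Fin 2) = Fin.cons 0 (fun _ => 0) := by
      funext l; cases l using Fin.cases <;> rfl
    obtain ⟨t, σ, rfl⟩ : ∃ t σ', σ = Fin.cons t σ' :=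
      ⟨σ 0, Fin.tail σ, (Fin.cons_self_tail σ).symm⟩
    have hs := congrFun₂ (siteBlock_block γ μ u 1 1 t 0) σ (fun _ => 0)
    have ho := congrFun₂ (siteBlock_one (n := L) t 0) σ (fun _ => 0)
    simp only [siteBlock] at hs ho
    rw [h1, hs, ho, Fin.prod_univ_succ]
    simp only [Fin.sum_univ_two, Matrix.add_apply, Matrix.smul_apply, ih]
    fin_cases t <;> simp [R, Fin.tail, mul_assoc]

theorem Z_zero (γ : ℂ) (μ y : Fin 0 → ℂ) : Z γ μ y = 1 := by
  simp [Z, Subsingleton.elim (fun _ => 1 : Fin 0 → Fin 2) (fun _ => 0)]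

theorem Z_eq_siteBlock {L : ℕ} (γ : ℂ) (μ y : Fin (L + 1) → ℂ) :
    Z γ μ y = siteBlock (bProd γ μ (List.ofFn y)) 1 0 (fun _ => 1) (fun _ => 0) := by
  rw [Z_eq_bProd, siteBlock]
  congr <;> (funext l; cases l using Fin.cases <;> rfl)

theorem bProd_perm {L : ℕ} {γ : ℂ} (μ : Fin L → ℂ) {l l' : List ℂ} (h : l.Perm l')
    (hl : l.Pairwise fun u v => a γ (u - v) ≠ 0) : bProd γ μ l = bProd γ μ l' := by
  refine List.Perm.prod_eq' (h.map _) ?_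
  rw [List.pairwise_map]
  exact hl.imp fun h => commute_B γ μ h

theorem ofFn_perm {n : ℕ} (y : Fin (n + 1) → ℂ) (j : Fin (n + 1)) :
    (List.ofFn y).Perm (y j :: List.ofFn (y ∘ j.succAbove)) := by
  have h := Equiv.Perm.ofFn_comp_perm j.cycleRange.symm y
  rw [List.ofFn_succ] at h
  simp only [Function.comp_apply, Fin.cycleRange_symm_zero, Fin.cycleRange_symm_succ] at h
  exact h.symm

theorem pairwise_ofFn_a {γ : ℂ} {n : ℕ} {y : Fin n → ℂ}
    (hy : ∀ i k, i ≠ k → a γ (y i - y k) ≠ 0) :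
    (List.ofFn y).Pairwise fun u v => a γ (u - v) ≠ 0 :=
  List.pairwise_ofFn.2 fun _ _ h => hy _ _ h.ne

/-- With `B (y j)` moved to the front, only the term with `D (y j)` at the left end remains, and the
left vector is an eigenvector of `D`. -/
theorem Z_of_eq {L : ℕ} {γ : ℂ} {μ y : Fin (L + 1) → ℂ}
    (hy : ∀ i k, i ≠ k → a γ (y i - y k) ≠ 0) (j : Fin (L + 1)) (hj : μ 0 = y j) :
    Z γ μ y = c γ 0 * (∏ l : Fin L, a γ (y j - μ l.succ)) *
      (∏ k, a γ (y (j.succAbove k) - y j)) * Z γ (Fin.tail μ) (y ∘ j.succAbove) := by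
  rw [Z_eq_siteBlock, bProd_perm μ (ofFn_perm y j) (pairwise_ofFn_a hy), siteBlock_bProd_cons,
    hj, sub_self, show b 0 = 0 by simp [b], zero_smul, add_zero, Matrix.smul_apply,
    Matrix.mul_apply]
  simp only [block_one_one_left, Matrix.one_apply, mul_ite, mul_one, mul_zero, ite_mul, zero_mul,
    Finset.sum_ite_eq, Finset.mem_univ, if_true, List.map_ofFn, List.prod_ofFn, Z_eq_bProd,
    smul_eq_mul, Function.comp_apply, Fin.tail]
  ring

/-- With `B (y j)` moved to the back, only the term with `D (y j)` at the right end remains, and the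
right vector is an eigenvector of `D`. -/
theorem Z_of_eq_add {L : ℕ} {γ : ℂ} {μ y : Fin (L + 1) → ℂ}
    (hy : ∀ i k, i ≠ k → a γ (y i - y k) ≠ 0) (j : Fin (L + 1)) (hj : μ 0 = y j + γ) :
    Z γ μ y = c γ 0 * (∏ l : Fin L, b (y j - μ l.succ)) *
      (∏ k, b (y (j.succAbove k) - (y j + γ))) * Z γ (Fin.tail μ) (y ∘ j.succAbove) := by
  rw [Z_eq_siteBlock, bProd_perm μ ((ofFn_perm y j).trans (List.perm_append_singleton _ _).symm)
    (pairwise_ofFn_a hy), siteBlock_bProd_append, hj, show a γ (y j - (y j + γ)) = 0 by simp [a],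
    zero_smul, zero_add, Matrix.smul_apply, Matrix.mul_apply]
  simp only [block_one_one_right, Matrix.one_apply, mul_ite, mul_one, mul_zero,
    Finset.sum_ite_eq', Finset.mem_univ, if_true, List.map_ofFn, List.prod_ofFn, Z_eq_bProd,
    smul_eq_mul, Function.comp_apply, Fin.tail]
  ring

/-- In each term one of the factors contributes the constant `c`, so the degree is one less than the
number of factors. The substitution `h` is the identity or, for crossing, `m ↦ γ - m`. -/
theorem trigPoly_siteBlock_bProd {L : ℕ} (γ : ℂ) (μ : Fin L → ℂ) (h : ℂ → ℂ)
    (hh : ∀ y, TrigPoly 1 fun m => b (y - h m)) (u : ℂ) (l : List ℂ) (σ τ : Fin L → Fin 2) :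
    TrigPoly l.length fun m =>
      siteBlock (bProd γ (Fin.cons (h m) μ : Fin (L + 1) → ℂ) (u :: l)) 1 0 σ τ := by
  have ha : ∀ y, TrigPoly 1 fun m => a γ (y - h m) := fun y => by
    simpa only [a, b, add_sub_right_comm] using hh (y + γ)
  induction l generalizing u σ τ with
  | nil =>
    simp only [siteBlock_bProd_cons]
    simp [bProd, siteBlock_one]
    exact TrigPoly.const _
  | cons v l ih =>
    simp only [siteBlock_bProd_cons γ _ u, Fin.cons_zero, Fin.tail_cons, Matrix.add_apply,
      Matrix.smul_apply, Matrix.mul_apply, smul_eq_mul, mul_assoc]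
    refine TrigPoly.add (TrigPoly.const_mul _ ?_) ?_
    · simp only [mul_comm (List.prod _)]
      exact (TrigPoly.list_prod (v :: l) ha).const_mul _
    · rw [List.length_cons, add_comm]
      exact (hh u).mul (TrigPoly.sum _ fun ρ _ => (ih v ρ τ).const_mul _)

theorem trigPoly_Z {L : ℕ} (γ : ℂ) (μ : Fin L → ℂ) (y : Fin (L + 1) → ℂ) {h : ℂ → ℂ}
    (hh : ∀ y, TrigPoly 1 fun m => b (y - h m)) :
    TrigPoly L fun m => Z γ (Fin.cons (h m) μ : Fin (L + 1) → ℂ) y := by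
  simp only [Z_eq_siteBlock, List.ofFn_succ]
  simpa using trigPoly_siteBlock_bProd γ μ h hh (y 0) (List.ofFn fun k : Fin L => y k.succ)
    (fun _ => 1) (fun _ => 0)

/-! ### Determinants of a diagonal matrix minus a Cauchy matrix -/

/-- The difference of a diagonal matrix and a trigonometric Cauchy matrix with scaled columns. -/
def cauchyPencil {n : ℕ} (γ : ℂ) (r y F Q : Fin n → ℂ) : Matrix (Fin n) (Fin n) ℂ :=
  fun α β => (if α = β then F β else 0) - c γ 0 / a γ (y β - r α) * Q β

theorem b_neg (u : ℂ) : b (-u) = -b u := Complex.sinh_neg u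

theorem b_sub_comm (u v : ℂ) : b (u - v) = -b (v - u) := by rw [← b_neg, neg_sub]

theorem b_sub_add (γ u v : ℂ) : b (u - (v + γ)) = -a γ (v - u) := by
  rw [b_sub_comm, a, b, add_sub_right_comm]

theorem a_sub_add (γ u v : ℂ) : a γ (u - (v + γ)) = b (u - v) := by
  rw [a, b]
  congr 1
  ring

theorem det_cauchyPencil_mul {n : ℕ} (γ : ℂ) (r y e F Q : Fin n → ℂ) :
    (cauchyPencil γ r y (fun k => e k * F k) (fun k => e k * Q k)).det =
      (∏ k, e k) * (cauchyPencil γ r y F Q).det := by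
  rw [← Matrix.det_mul_row]
  congr 1
  ext α β
  simp only [cauchyPencil, Matrix.of_apply]
  split_ifs <;> ring

/-- Column `j` has only its diagonal entry. -/
theorem det_cauchyPencil_of_right_eq_zero {n : ℕ} (γ : ℂ) (r y F Q : Fin (n + 1) → ℂ)
    (j : Fin (n + 1)) (hQ : Q j = 0) :
    (cauchyPencil γ r y F Q).det =
      F j * (cauchyPencil γ (r ∘ j.succAbove) (y ∘ j.succAbove) (F ∘ j.succAbove)
        (Q ∘ j.succAbove)).det := by
  rw [Matrix.det_succ_column _ j, Finset.sum_eq_single j]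
  · simp only [cauchyPencil, if_true, hQ, mul_zero, sub_zero, ← two_mul, pow_mul]
    rw [neg_one_sq, one_pow, one_mul]
    congr 2
    ext α β
    simp [cauchyPencil, Matrix.submatrix_apply]
  · intro i _ hi
    simp [cauchyPencil, hi, hQ]
  · simp

/-- Column `j` is a multiple of a Cauchy column, with pivot `-Q j`. Eliminating it multiplies each
remaining Cauchy entry by a row factor and a column factor, by `a_mul_a`, and leaves the remaining
diagonal part unchanged because `F` does not enter row `j`. -/
theorem det_cauchyPencil_of_left_eq_zero {n : ℕ} (γ : ℂ) (r y F Q : Fin (n + 1) → ℂ)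
    (j : Fin (n + 1)) (hF : F j = 0) (hy : y j = r j) (hc : c γ 0 ≠ 0)
    (ha : ∀ α β, a γ (y β - r α) ≠ 0) (hb : ∀ k, k ≠ j → b (r j - r k) ≠ 0) :
    (cauchyPencil γ r y F Q).det =
      -Q j * (cauchyPencil γ (r ∘ j.succAbove) (y ∘ j.succAbove) (F ∘ j.succAbove)
        (fun k => b (r j - r (j.succAbove k)) * b (y (j.succAbove k) - r j) /
          (a γ (r j - r (j.succAbove k)) * a γ (y (j.succAbove k) - r j)) *
            Q (j.succAbove k))).det := by
  set ρ : Fin (n + 1) → ℂ := fun α => c γ 0 / a γ (r j - r α) with hρ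
  have hac : a γ 0 = c γ 0 := by simp [a, c]
  have har : ∀ α, a γ (r j - r α) ≠ 0 := fun α => hy ▸ ha α j
  -- The row `j` times `ρ` is subtracted from the other rows.
  set M : Matrix (Fin (n + 1)) (Fin (n + 1)) ℂ := fun α β =>
    if α = j then cauchyPencil γ r y F Q j β
    else cauchyPencil γ r y F Q α β - ρ α * cauchyPencil γ r y F Q j β with hM
  have h1 : (cauchyPencil γ r y F Q).det = M.det := by
    refine Matrix.det_eq_of_forall_row_eq_smul_add_const (fun α => if α = j then 0 else ρ α) j
      (by simp) fun α β => ?_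
    by_cases hα : α = j <;> simp [hM, hα]
  have h2 : ∀ α, α ≠ j → M α j = 0 := by
    intro α hα
    simp only [hM, hα, if_false, cauchyPencil, hF, ite_self, zero_sub, hρ, hy, sub_self, hac,
      div_self hc]
    ring
  have h3 : M j j = -Q j := by
    simp [hM, cauchyPencil, hF, hy, hac, div_self hc]
  rw [h1, Matrix.det_succ_column _ j, Finset.sum_eq_single j]
  · rw [← two_mul, pow_mul, neg_one_sq, one_pow, one_mul, h3]
    congr 1
    -- The row factors `b / a` are turned into column factors by conjugation with a diagonal matrix,
    -- which needs them nonzero.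
    have hprod : ∏ k, b (r j - r (j.succAbove k)) / a γ (r j - r (j.succAbove k)) ≠ 0 :=
      Finset.prod_ne_zero_iff.2 fun k _ =>
        div_ne_zero (hb _ (Fin.succAbove_ne j k)) (har _)
    refine mul_left_cancel₀ hprod ?_
    rw [← Matrix.det_mul_row, ← Matrix.det_mul_column]
    congr 1
    ext α β
    simp only [Matrix.of_apply, Matrix.submatrix_apply]
    simp only [hM, Fin.succAbove_ne, if_false,
      cauchyPencil, hρ, Function.comp_apply, Fin.succAbove_right_inj, (Fin.succAbove_ne _ _).symm]
    have hA := a_mul_a γ (r j - r (j.succAbove α)) (y (j.succAbove β) - r j)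
    rw [show r j - r (j.succAbove α) + (y (j.succAbove β) - r j) =
      y (j.succAbove β) - r (j.succAbove α) by ring] at hA
    have n1 := har (j.succAbove α)
    have n2 := har (j.succAbove β)
    have n3 := ha j (j.succAbove β)
    have n4 := ha (j.succAbove α) (j.succAbove β)
    have key : c γ 0 / a γ (y (j.succAbove β) - r (j.succAbove α)) -
        c γ 0 / a γ (r j - r (j.succAbove α)) * (c γ 0 / a γ (y (j.succAbove β) - r j)) =
        c γ 0 / a γ (y (j.succAbove β) - r (j.succAbove α)) *
          (b (r j - r (j.succAbove α)) * b (y (j.succAbove β) - r j) /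
            (a γ (r j - r (j.succAbove α)) * a γ (y (j.succAbove β) - r j))) := by
      field_simp
      linear_combination hA
    by_cases h : α = β
    · subst h
      simp only [if_true]
      linear_combination (-b (r j - r (j.succAbove α)) / a γ (r j - r (j.succAbove α)) *
        Q (j.succAbove α)) * key
    · simp only [h, if_false]
      linear_combination (-b (r j - r (j.succAbove β)) / a γ (r j - r (j.succAbove β)) *
        Q (j.succAbove β)) * key
  · intro i _ hi
    simp [h2 i hi]
  · simp

theorem trigPoly_det {n : ℕ} {M : ℂ → Matrix (Fin n) (Fin n) ℂ}
    (hM : ∀ α β, TrigPoly 1 fun u => M u α β) : TrigPoly n fun u => (M u).det := by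
  simp only [Matrix.det_apply']
  refine TrigPoly.sum _ fun σ _ => TrigPoly.const_mul _ ?_
  simpa using TrigPoly.prod Finset.univ fun i _ => hM (σ i) i

/-! ### Recursions for the determinants of the partition function -/

/-- The coefficients of the diagonal part of the matrices of the partition function. -/
def diagCoeff {n : ℕ} (γ : ℂ) (μ φ y : Fin n → ℂ) (k : Fin n) : ℂ :=
  φ k * ∏ l, a γ (y k - μ l)

/-- The coefficients of the Cauchy part of the matrices of the partition function. -/
def cauchyCoeff {n : ℕ} (γ : ℂ) (μ ψ r y : Fin n → ℂ) (k : Fin n) : ℂ :=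
  ψ k * (∏ l, b (y k - μ l)) * ∏ i, if i = k then 1 else a γ (y k - r i) / b (y k - r i)

section
variable {n : ℕ} (γ : ℂ) (μ φ ψ r y : Fin (n + 1) → ℂ) (j : Fin (n + 1)) (k : Fin n)

theorem diagCoeff_self : diagCoeff γ μ φ y j =
    φ j * (a γ (y j - μ 0) * ∏ l : Fin n, a γ (y j - μ l.succ)) := by
  rw [diagCoeff, Fin.prod_univ_succ]

theorem diagCoeff_succAbove : diagCoeff γ μ φ y (j.succAbove k) =
    a γ (y (j.succAbove k) - μ 0) *
      diagCoeff γ (Fin.tail μ) (φ ∘ j.succAbove) (y ∘ j.succAbove) k := by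
  simp only [diagCoeff, Fin.prod_univ_succ, Function.comp_apply, Fin.tail]
  ring

theorem cauchyCoeff_self : cauchyCoeff γ μ ψ r y j =
    ψ j * (b (y j - μ 0) * ∏ l : Fin n, b (y j - μ l.succ)) *
      ∏ k, a γ (y j - r (j.succAbove k)) / b (y j - r (j.succAbove k)) := by
  rw [cauchyCoeff, Fin.prod_univ_succ, Fin.prod_univ_succAbove _ j]
  simp [Fin.succAbove_ne]

theorem cauchyCoeff_succAbove : cauchyCoeff γ μ ψ r y (j.succAbove k) =
    b (y (j.succAbove k) - μ 0) *
      (a γ (y (j.succAbove k) - r j) / b (y (j.succAbove k) - r j)) *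
      cauchyCoeff γ (Fin.tail μ) (ψ ∘ j.succAbove) (r ∘ j.succAbove) (y ∘ j.succAbove) k := by
  simp only [cauchyCoeff, Fin.prod_univ_succ (fun l => b _), Fin.prod_univ_succAbove _ j,
    Function.comp_apply, Fin.tail, (Fin.succAbove_ne j k).symm, if_false,
    Fin.succAbove_right_inj]
  ring

end

theorem Z_one (γ : ℂ) (μ y : Fin 1 → ℂ) : Z γ μ y = c γ 0 := by
  rw [Z_eq_siteBlock, List.ofFn_succ, siteBlock_bProd_cons]
  simp [bProd, siteBlock_one, block_zero, Subsingleton.elim (fun _ => 1 : Fin 0 → Fin 2)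
    (fun _ => 0)]

/-- The matrix of the partition function. -/
def partitionMatrix {n : ℕ} (γ : ℂ) (μ φ ψ r y : Fin n → ℂ) : Matrix (Fin n) (Fin n) ℂ :=
  cauchyPencil γ r y (diagCoeff γ μ φ y) (cauchyCoeff γ μ ψ r y)

theorem trigPoly_det_partitionMatrix {n : ℕ} (γ : ℂ) (μ : Fin n → ℂ)
    (φ ψ r y : Fin (n + 1) → ℂ) :
    TrigPoly (n + 1) fun m =>
      (partitionMatrix γ (Fin.cons m μ : Fin (n + 1) → ℂ) φ ψ r y).det := by
  refine trigPoly_det fun α β => ?_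
  simp only [partitionMatrix, cauchyPencil, diagCoeff, cauchyCoeff,
    Fin.prod_univ_succ (fun l => b _), Fin.prod_univ_succ (fun l => a γ _), Fin.cons_zero, Fin.cons_succ]
  have ha : ∀ y, TrigPoly 1 fun m => a γ (y - m) := fun y => by
    simpa only [a, b, add_sub_right_comm] using trigPoly_b (y + γ)
  refine TrigPoly.sub ?_ (TrigPoly.const_mul _ ?_)
  · split_ifs
    · refine TrigPoly.const_mul _ ?_
      simp only [mul_comm (a γ _)]
      exact (ha _).const_mul _
    · exact TrigPoly.zero _
  · simp only [mul_comm _ (Finset.prod _ fun i => ite _ _ _)]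
    refine TrigPoly.const_mul _ (TrigPoly.const_mul _ ?_)
    simp only [mul_comm (b _)]
    exact (trigPoly_b _).const_mul _

/-- The Cauchy part of column `j` vanishes. In every other column the factor of the diagonal part
and that of the Cauchy part coincide, since `b (y k - y j)` cancels against a denominator; so the
factor comes out of the determinant. -/
theorem det_partitionMatrix_of_eq {n : ℕ} (γ : ℂ) (μ φ ψ r y : Fin (n + 1) → ℂ)
    (j : Fin (n + 1)) (hj : μ 0 = y j)
    (hr : y j = r j) (hb : ∀ k, k ≠ j → b (y k - y j) ≠ 0) :
    (partitionMatrix γ μ φ ψ r y).det =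
      φ j * c γ 0 * (∏ l : Fin n, a γ (y j - μ l.succ)) *
        (∏ k, a γ (y (j.succAbove k) - y j)) *
        (partitionMatrix γ (Fin.tail μ) (φ ∘ j.succAbove) (ψ ∘ j.succAbove) (r ∘ j.succAbove)
          (y ∘ j.succAbove)).det := by
  have hQ : cauchyCoeff γ μ ψ r y j = 0 := by
    rw [cauchyCoeff_self, hj, sub_self, show b 0 = 0 by simp [b]]
    ring
  rw [partitionMatrix, det_cauchyPencil_of_right_eq_zero γ r y _ _ j hQ, diagCoeff_self, hj,
    sub_self, show a γ 0 = c γ 0 by simp [a, c]]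
  have h1 : diagCoeff γ μ φ y ∘ j.succAbove = fun k => a γ (y (j.succAbove k) - y j) *
      diagCoeff γ (Fin.tail μ) (φ ∘ j.succAbove) (y ∘ j.succAbove) k := by
    funext k
    rw [Function.comp_apply, diagCoeff_succAbove, hj]
  have h2 : cauchyCoeff γ μ ψ r y ∘ j.succAbove = fun k => a γ (y (j.succAbove k) - y j) *
      cauchyCoeff γ (Fin.tail μ) (ψ ∘ j.succAbove) (r ∘ j.succAbove) (y ∘ j.succAbove) k := by
    funext k
    rw [Function.comp_apply, cauchyCoeff_succAbove, hj, ← hr,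
      mul_div_cancel₀ _ (hb _ (Fin.succAbove_ne j k))]
  rw [h1, h2, det_cauchyPencil_mul, partitionMatrix]
  ring

/-- The counterpart at the other kind of point: the diagonal part of column `j` vanishes, and after
the elimination each remaining column again has one factor common to both parts. -/
theorem det_partitionMatrix_of_eq_add {n : ℕ} (γ : ℂ) (μ φ ψ r y : Fin (n + 1) → ℂ)
    (j : Fin (n + 1)) (hj : μ 0 = y j + γ) (hr : y j = r j) (hc : c γ 0 ≠ 0)
    (hφ : ∀ k, φ k = 0 ∨ y k = r k)
    (ha : ∀ α β, a γ (y β - r α) ≠ 0) (hb : ∀ k, k ≠ j → b (r j - r k) ≠ 0)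
    (hby : ∀ k, k ≠ j → b (y k - y j) ≠ 0) :
    (partitionMatrix γ μ φ ψ r y).det =
      ψ j * c γ 0 * (∏ l : Fin n, b (y j - μ l.succ)) *
        (∏ k, b (y (j.succAbove k) - (y j + γ))) *
        (partitionMatrix γ (Fin.tail μ) (φ ∘ j.succAbove) (ψ ∘ j.succAbove) (r ∘ j.succAbove)
          (y ∘ j.succAbove)).det := by
  have hF : diagCoeff γ μ φ y j = 0 := by
    rw [diagCoeff_self, hj, a_sub_add, sub_self, show b 0 = 0 by simp [b]]
    ring
  rw [partitionMatrix, det_cauchyPencil_of_left_eq_zero γ r y _ _ j hF hr hc ha hb,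
    cauchyCoeff_self, hj]
  -- The common column factor; its quotient `b / a` later cancels the product in `cauchyCoeff_self`.
  set e : Fin n → ℂ := fun k => b (y (j.succAbove k) - (y j + γ)) *
    (b (r j - r (j.succAbove k)) / a γ (r j - r (j.succAbove k))) with he
  have har : ∀ α, a γ (r j - r α) ≠ 0 := fun α => hr ▸ ha α j
  have h1 : diagCoeff γ μ φ y ∘ j.succAbove = fun k => e k *
      diagCoeff γ (Fin.tail μ) (φ ∘ j.succAbove) (y ∘ j.succAbove) k := by
    funext k
    rw [Function.comp_apply, diagCoeff_succAbove, hj]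
    -- A column with `φ = 0` has no diagonal part to match; otherwise `y = r` makes the two factors
    -- equal.
    rcases hφ (j.succAbove k) with h | h
    · simp [diagCoeff, h]
    · simp only [he]
      congr 1
      rw [a_sub_add, b_sub_add, h, hr, b_sub_comm]
      field_simp [har (j.succAbove k)]
  have h2 : (fun k => b (r j - r (j.succAbove k)) * b (y (j.succAbove k) - r j) /
          (a γ (r j - r (j.succAbove k)) * a γ (y (j.succAbove k) - r j)) *
            cauchyCoeff γ μ ψ r y (j.succAbove k)) = fun k => e k *
      cauchyCoeff γ (Fin.tail μ) (ψ ∘ j.succAbove) (r ∘ j.succAbove) (y ∘ j.succAbove) k := by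
    funext k
    rw [cauchyCoeff_succAbove, hj]
    simp only [he]
    have n1 := har (j.succAbove k)
    have n2 := ha j (j.succAbove k)
    have n3 := hby _ (Fin.succAbove_ne j k)
    rw [hr] at n3 ⊢
    field_simp
  rw [h1, h2, det_cauchyPencil_mul, partitionMatrix]
  have h3 : (∏ k, a γ (y j - r (j.succAbove k)) / b (y j - r (j.succAbove k))) * ∏ k, e k =
      ∏ k, b (y (j.succAbove k) - (y j + γ)) := by
    rw [← Finset.prod_mul_distrib]
    refine Finset.prod_congr rfl fun k _ => ?_
    have n1 := har (j.succAbove k)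
    have n2 := hb _ (Fin.succAbove_ne j k)
    simp only [he, hr]
    field_simp
  have h4 : b (y j - (y j + γ)) = -c γ 0 := by
    rw [b_sub_add, sub_self, a, c, zero_add]
  rw [← h3, h4]
  ring

/-! ### The determinant formula by interpolation -/

/-- Here `t` plays the role of `x₀`. Columns of the first kind are those of `W`, a column of the
second kind is the replaced one of `W_i`. Both alternatives survive the deletion of a column, so one
induction proves both formulas, with `P` carrying the genericity; its case `u = v` gives `sinh γ ≠
0`. -/
theorem Z_mul_prod_eq_det {γ : ℂ} {P : Set ℂ} (hPa : ∀ u ∈ P, ∀ v ∈ P, a γ (u - v) ≠ 0)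
    (hPb : ∀ u ∈ P, ∀ v ∈ P, u ≠ v → b (u - v) ≠ 0) {t : ℂ} (ht : t ∈ P) {n : ℕ}
    (μ φ ψ r y : Fin n → ℂ) (hrP : ∀ k, r k ∈ P) (hr : Function.Injective r)
    (hy : Function.Injective y) (htr : ∀ k, t ≠ r k)
    (h : ∀ k, (y k = r k ∧ φ k = 1 ∧ ψ k = a γ (r k - t) / b (r k - t)) ∨
      (y k = t ∧ φ k = 0 ∧ ψ k = -(a γ (t - r k) / b (t - r k)))) :
    Z γ μ y * ∏ l, b (t - μ l) =
      (partitionMatrix γ μ φ ψ r y).det * ∏ k, b (t - r k) := by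
  have hc : c γ 0 ≠ 0 := by simpa [a, c] using hPa t ht t ht
  induction n with
  | zero => simp [Z_zero]
  | succ n ih =>
    have hyP : ∀ k, y k ∈ P := fun k => by
      rcases h k with h | h
      · exact h.1 ▸ hrP k
      · exact h.1 ▸ ht
    have hya : ∀ i k, i ≠ k → a γ (y i - y k) ≠ 0 := fun i k _ => hPa _ (hyP i) _ (hyP k)
    have hyb : ∀ i k, i ≠ k → b (y i - y k) ≠ 0 := fun i k hik =>
      hPb _ (hyP i) _ (hyP k) (hy.ne hik)
    have ih' : ∀ (μ : Fin n → ℂ) (j : Fin (n + 1)),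
        Z γ μ (y ∘ j.succAbove) * ∏ l, b (t - μ l) =
          (partitionMatrix γ μ (φ ∘ j.succAbove) (ψ ∘ j.succAbove) (r ∘ j.succAbove)
            (y ∘ j.succAbove)).det * ∏ k, b (t - r (j.succAbove k)) := fun μ j =>
      ih μ _ _ _ _ (fun k => hrP _) (hr.comp Fin.succAbove_right_injective)
        (hy.comp Fin.succAbove_right_injective) (fun k => htr _) (fun k => h _)
    by_cases hj : ∃ j, y j = r j ∧ φ j = 1 ∧ ψ j = a γ (r j - t) / b (r j - t)
    · obtain ⟨j₀, hj₀, -, hψ⟩ := hj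
      suffices H : (fun m => Z γ (Fin.cons m (Fin.tail μ) : Fin (n + 1) → ℂ) y *
          ∏ l, b (t - (Fin.cons m (Fin.tail μ) : Fin (n + 1) → ℂ) l)) =
          fun m => (partitionMatrix γ (Fin.cons m (Fin.tail μ) : Fin (n + 1) → ℂ) φ ψ r y).det *
            ∏ k, b (t - r k) by
        have := congrFun H (μ 0)
        simpa only [Fin.cons_self_tail] using this
      -- Degree `n + 1` calls for `n + 2` nodes: all the `y k`, and `y j₀ + γ` for one column of the
      -- first kind.
      refine TrigPoly.eq_of_nodes (n := n + 1) (ι := Option (Fin (n + 1))) ?_ ?_ (by simp)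
        (fun o => o.elim (y j₀ + γ) y) ?_ ?_
      · refine (trigPoly_Z γ _ y (h := fun m => m) trigPoly_b).mul ?_
        simp only [Fin.prod_univ_succ, Fin.cons_zero, Fin.cons_succ, mul_comm (b _)]
        exact (trigPoly_b t).const_mul _
      · simp only [mul_comm (Matrix.det _)]
        exact (trigPoly_det_partitionMatrix γ _ φ ψ r y).const_mul _
      · rintro (_ | i) (_ | k) hik
        · exact absurd rfl hik
        · simp only [Option.elim]
          rw [b_sub_comm, b_sub_add, neg_neg]
          exact hPa _ (hyP _) _ (hyP _)
        · simp only [Option.elim]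
          rw [b_sub_add, neg_ne_zero]
          exact hPa _ (hyP _) _ (hyP _)
        · exact hyb i k fun h => hik (h ▸ rfl)
      · rintro (_ | j)
        · simp only [Option.elim]
          rw [Z_of_eq_add hya j₀ rfl, det_partitionMatrix_of_eq_add γ _ φ ψ r y j₀ rfl hj₀ hc
            (fun k => (h k).symm.imp (fun h => h.2.1) (fun h => h.1))
            (fun α β => hPa _ (hyP β) _ (hrP α))
            (fun k hk => hPb _ (hrP _) _ (hrP _) (hr.ne hk.symm)) (fun k hk => hyb k j₀ hk)]
          simp only [Fin.prod_univ_succ (fun l => b (t - (Fin.cons _ _ : Fin (n + 1) → ℂ) l)),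
            Fin.prod_univ_succAbove (fun k => b (t - r k)) j₀, Fin.cons_zero, Fin.cons_succ,
            Fin.tail_cons]
          -- The value of `ψ` is the one that turns the factor `b (t - r j₀)` into the new factor `b
          -- (t - μ 0)` at this node.
          have hψ' : ψ j₀ * b (t - r j₀) = b (t - (y j₀ + γ)) := by
            rw [hψ, b_sub_add, hj₀, b_sub_comm t]
            field_simp [hPb _ (hrP j₀) _ ht (htr j₀).symm]
          rw [← hψ']
          have := ih' (Fin.tail μ) j₀
          linear_combination (c γ 0 * (∏ l : Fin n, b (y j₀ - Fin.tail μ l)) *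
            (∏ k, b (y (j₀.succAbove k) - (y j₀ + γ))) * (ψ j₀ * b (t - r j₀))) * this
        · simp only [Option.elim]
          rcases h j with ⟨h1, h2, -⟩ | ⟨h1, h2, -⟩
          · rw [Z_of_eq hya j rfl, det_partitionMatrix_of_eq γ _ φ ψ r y j rfl h1
              (fun k hk => hyb k j hk), h2]
            simp only [Fin.prod_univ_succ (fun l => b (t - (Fin.cons _ _ : Fin (n + 1) → ℂ) l)),
              Fin.prod_univ_succAbove (fun k => b (t - r k)) j, Fin.cons_zero, Fin.cons_succ,
              Fin.tail_cons]
            rw [← h1]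
            have := ih' (Fin.tail μ) j
            linear_combination (c γ 0 * (∏ l : Fin n, a γ (y j - Fin.tail μ l)) *
              (∏ k, a γ (y (j.succAbove k) - y j)) * b (t - y j)) * this
          -- At the node `t` both sides vanish: the left through `b (t - μ 0)`, the right because
          -- column `j` is zero.
          · have hb0 : b 0 = 0 := by simp [b]
            rw [Fin.prod_univ_succ, Fin.cons_zero, h1, sub_self, hb0, partitionMatrix,
              det_cauchyPencil_of_right_eq_zero γ r y _ _ j, diagCoeff, h2]
            · ring
            · rw [cauchyCoeff_self, Fin.cons_zero, h1, sub_self, hb0]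
              ring
    -- Without a column of the first kind all `y k` equal `t`, so injectivity leaves a single
    -- column.
    · have hs : ∀ j, y j = t ∧ φ j = 0 ∧ ψ j = -(a γ (t - r j) / b (t - r j)) := fun j =>
        (h j).resolve_left fun h => hj ⟨j, h⟩
      obtain rfl : n = 0 := by
        have : Subsingleton (Fin (n + 1)) := ⟨fun i k => hy ((hs i).1.trans (hs k).1.symm)⟩
        have := Fintype.card_le_one_iff_subsingleton.2 this
        simpa using this
      have n1 := hPa _ ht _ (hrP 0)
      have n2 := hPb _ ht _ (hrP 0) (htr 0)
      rw [Z_one]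
      simp [partitionMatrix, cauchyPencil, diagCoeff, cauchyCoeff, hs 0]
      field_simp

/-! ### Crossing symmetry and continuity in `γ` -/

/-- A crossing symmetry of the partition function, for generic `γ`. -/
theorem Z_crossing_of_generic {n : ℕ} {γ : ℂ} (μ y : Fin n → ℂ)
    (hya : ∀ i k, i ≠ k → a γ (y i - y k) ≠ 0) (hyb : ∀ i k, i ≠ k → b (y i - y k) ≠ 0) :
    Z γ (fun l => γ - μ l) (fun k => -y k) = Z γ μ y := by
  induction n with
  | zero => simp [Z_zero]
  | succ n ih =>
    have hcons : ∀ m, (fun l => γ - (Fin.cons m (Fin.tail μ) : Fin (n + 1) → ℂ) l) =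
        (Fin.cons (γ - m) (fun l => γ - Fin.tail μ l) : Fin (n + 1) → ℂ) := fun m => by
      funext l
      cases l using Fin.cases <;> rfl
    suffices H : (fun m => Z γ (Fin.cons (γ - m) (fun l => γ - Fin.tail μ l) : Fin (n + 1) → ℂ)
        (fun k => -y k)) = fun m => Z γ (Fin.cons m (Fin.tail μ) : Fin (n + 1) → ℂ) y by
      have := congrFun H (μ 0)
      simp only [← hcons, Fin.cons_self_tail] at this
      exact this
    -- Degree `n` makes the `n + 1` nodes `y j` enough. Crossing sends `μ 0 = y j` to the other
    -- special point, so `Z_of_eq_add` on the left meets `Z_of_eq` on the right.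
    refine TrigPoly.eq_of_nodes (n := n) (ι := Fin (n + 1))
      (trigPoly_Z γ _ _ (h := fun m => γ - m) fun y => trigPoly_b_reflect y γ)
      (trigPoly_Z γ _ _ (h := fun m => m) trigPoly_b) (by simp) y hyb fun j => ?_
    have hya' : ∀ i k, i ≠ k → a γ (-y i - -y k) ≠ 0 := fun i k hik => by
      rw [neg_sub_neg]
      exact hya k i hik.symm
    rw [Z_of_eq_add (y := fun k => -y k) hya' j (by rw [Fin.cons_zero]; ring), Z_of_eq hya j rfl]
    simp only [Fin.cons_succ, Fin.tail_cons]
    have h1 : ∀ l, b (-y j - (γ - Fin.tail μ l)) = -a γ (y j - Fin.tail μ l) := fun l => by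
      rw [a, b, ← Complex.sinh_neg]
      congr 1
      ring
    have h2 : ∀ k, b (-y (j.succAbove k) - (-y j + γ)) = -a γ (y (j.succAbove k) - y j) :=
      fun k => by
        rw [b_sub_add, neg_sub_neg]
    have h3 := ih (Fin.tail μ) (y ∘ j.succAbove)
      (fun i k hik => hya _ _ (Fin.succAbove_right_injective.ne hik))
      (fun i k hik => hyb _ _ (Fin.succAbove_right_injective.ne hik))
    have h4 : ((fun k => -y k) ∘ j.succAbove) = fun k => -(y ∘ j.succAbove) k := rfl
    simp only [h1, h2, h4, h3, Finset.prod_neg, Finset.card_univ, Fintype.card_fin]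
    have h5 : ((-1 : ℂ) ^ n) * (-1) ^ n = 1 := by rw [← mul_pow]; simp
    linear_combination (c γ 0 * (∏ l, a γ (y j - Fin.tail μ l)) *
      (∏ k, a γ (y (j.succAbove k) - y j)) * Z γ (Fin.tail μ) (y ∘ j.succAbove)) * h5

theorem countable_setOf_a_eq_zero (u : ℂ) : {γ | a γ u = 0}.Countable := by
  refine (Set.countable_range fun n : ℤ => n * (Real.pi * Complex.I) - u).mono fun γ hγ => ?_
  have h : Complex.exp (2 * (u + γ)) = 1 := by
    by_contra hne
    have hγ' : b ((u + γ) - 0) = 0 := by rw [sub_zero]; exact hγ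
    exact hne (by
      have h1 : Complex.exp (u + γ) = Complex.exp (-(u + γ)) := by
        rw [sub_zero, b, Complex.sinh, div_eq_zero_iff, sub_eq_zero] at hγ'
        exact hγ'.resolve_right two_ne_zero
      rw [two_mul, Complex.exp_add]
      nth_rewrite 1 [h1]
      rw [← Complex.exp_add, neg_add_cancel, Complex.exp_zero])
  obtain ⟨n, hn⟩ := Complex.exp_eq_one_iff.1 h
  exact ⟨n, by linear_combination -hn / 2⟩

/-- Continuous functions of `γ` that agree for generic `γ` are equal. -/
theorem eq_of_generic {ι : Type*} [Countable ι] (u : ι → ℂ) {f g : ℂ → ℂ} (hf : Continuous f)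
    (hg : Continuous g) (h : ∀ γ, (∀ i, a γ (u i) ≠ 0) → f γ = g γ) (γ : ℂ) : f γ = g γ := by
  have hd : Dense (⋃ i, {γ | a γ (u i) = 0})ᶜ :=
    (Set.countable_iUnion fun i => countable_setOf_a_eq_zero (u i)).dense_compl ℂ
  refine congrFun (hf.ext_on hd hg fun γ hγ => h γ ?_) γ
  simpa using hγ

theorem continuous_a (u : ℂ) : Continuous fun γ => a γ u :=
  Complex.continuous_sinh.comp (by fun_prop)

theorem continuous_c (u : ℂ) : Continuous fun γ => c γ u := Complex.continuous_sinh

/-- The inhomogeneities may vary with `γ` because crossing replaces them by `γ - μ`. -/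
theorem continuous_Z {L : ℕ} {μ : ℂ → Fin L → ℂ} (hμ : Continuous μ) (y : Fin L → ℂ) :
    Continuous fun γ => Z γ (μ γ) y := by
  have hR : ∀ u : ℂ → ℂ, Continuous u → ∀ p q, Continuous fun γ => R γ (u γ) p q := by
    intro u hu p q
    have := Complex.continuous_sinh
    unfold R a b c
    split_ifs <;> fun_prop
  have hT : ∀ u, Continuous fun γ => monodromy γ (μ γ) u := by
    intro u
    simp only [monodromy, List.ofFn_eq_map]
    refine continuous_list_prod _ fun i _ => continuous_matrix fun p q => ?_
    unfold RAux
    split_ifs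
    · exact hR _ (by fun_prop) _ _
    · exact continuous_const
  have hB : ∀ u, Continuous fun γ => B γ (μ γ) u := fun u =>
    continuous_matrix fun σ τ => (hT u).matrix_elem _ _
  simp only [Z, List.ofFn_eq_map]
  exact (continuous_list_prod _ fun j _ => hB (y j)).matrix_elem _ _

theorem Z_crossing {n : ℕ} (γ : ℂ) (μ y : Fin n → ℂ) (hyb : ∀ i k, i ≠ k → b (y i - y k) ≠ 0) :
    Z γ (fun l => γ - μ l) (fun k => -y k) = Z γ μ y :=
  eq_of_generic (fun p : Fin n × Fin n => y p.1 - y p.2)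
    (continuous_Z (μ := fun γ l => γ - μ l) (by fun_prop) _)
    (continuous_Z (μ := fun _ => μ) continuous_const _)
    (fun _ h => Z_crossing_of_generic μ y (fun i k _ => h (i, k)) hyb) γ

/-! ### Identification of `W` and `W_i` -/

section
variable {L : ℕ} (γ : ℂ) (μ : Fin L → ℂ) (x : Fin (L + 1) → ℂ)

theorem continuous_det_W : Continuous fun γ => (W γ μ x).det := by
  refine (continuous_matrix fun α β => ?_).matrix_det
  have := continuous_a
  have := continuous_c
  unfold W
  split_ifs <;> fun_prop

theorem continuous_det_WCol (i : Fin L) : Continuous fun γ => (WCol γ μ x i).det := by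
  refine (continuous_matrix fun α β => ?_).matrix_det
  have := continuous_a
  have := continuous_c
  unfold WCol W
  split_ifs <;> fun_prop

theorem prod_filter_ne {ι : Type*} [Fintype ι] [DecidableEq ι] {p q : ι} (h : p ≠ q)
    (f : ι → ℂ) : ∏ k ∈ Finset.univ.filter (fun k => k ≠ q), f k =
      f p * ∏ k ∈ Finset.univ.filter (fun k => k ≠ p ∧ k ≠ q), f k := by
  rw [← Finset.mul_prod_erase _ _ (a := p) (by simpa using h)]
  congr 2
  ext k
  simp

theorem prod_filter_ne_succ (β : Fin L) (f : Fin (L + 1) → ℂ) :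
    ∏ k ∈ Finset.univ.filter (fun k => k ≠ β.succ), f k =
      f 0 * ∏ k : Fin L, if k = β then 1 else f k.succ := by
  rw [Finset.prod_filter, Fin.prod_univ_succ, if_pos (Fin.succ_ne_zero β).symm]
  congr 1
  refine Finset.prod_congr rfl fun k _ => ?_
  simp [ite_not]

variable {γ x}

/-- Off the diagonal, the factor `k = α` is inserted into the product and divided out again, which
trades `b` for `a` in the denominator with a sign; on the diagonal the Cauchy factor is `c / a γ 0 =
1`. -/
theorem W_apply_eq (hx : ∀ i j : Fin (L + 1), i ≠ j → b (x i - x j) ≠ 0)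
    (hg : ∀ i j, a γ (x i - x j) ≠ 0)
    (α β : Fin L) :
    W γ μ x α β = (if α = β then ∏ l, a γ (x β.succ - μ l) else 0) -
      c γ 0 / a γ (x β.succ - x α.succ) *
        (a γ (x β.succ - x 0) / b (x β.succ - x 0) * (∏ l, b (x β.succ - μ l)) *
          ∏ i : Fin L, if i = β then 1 else
            a γ (x β.succ - x i.succ) / b (x β.succ - x i.succ)) := by
  have hP := prod_filter_ne_succ β fun k => a γ (x β.succ - x k) / b (x β.succ - x k)
  by_cases h : α = β
  · subst h
    have hac : a γ (x α.succ - x α.succ) = c γ 0 := by simp [a, c]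
    have hc : c γ 0 ≠ 0 := hac ▸ hg α.succ α.succ
    rw [W, if_pos rfl, if_pos rfl, hac, div_self hc, hP]
    ring
  · have hne : α.succ ≠ β.succ := fun h' => h (Fin.succ_injective _ h')
    rw [prod_filter_ne hne] at hP
    rw [W, if_neg (Ne.symm h), if_neg h, b_sub_comm (x α.succ)]
    have n1 := hg β.succ α.succ
    have n2 := hx _ _ hne.symm
    have hc : c γ (x α.succ - x β.succ) = c γ 0 := rfl
    rw [hc]
    have e : c γ 0 / a γ (x β.succ - x α.succ) *
        (a γ (x β.succ - x 0) / b (x β.succ - x 0) * (∏ l, b (x β.succ - μ l)) *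
          ∏ i : Fin L, if i = β then 1 else
            a γ (x β.succ - x i.succ) / b (x β.succ - x i.succ)) =
        c γ 0 / a γ (x β.succ - x α.succ) * (∏ l, b (x β.succ - μ l)) *
        (a γ (x β.succ - x 0) / b (x β.succ - x 0) *
          ∏ i : Fin L, if i = β then 1 else
            a γ (x β.succ - x i.succ) / b (x β.succ - x i.succ)) := by ring
    rw [e, ← hP]
    field_simp
    ring

theorem Z_X_of_generic (hx : ∀ i j : Fin (L + 1), i ≠ j → b (x i - x j) ≠ 0)
    (hg : ∀ i j, a γ (x i - x j) ≠ 0) :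
    Z γ μ (X x) * ∏ l, b (x 0 - μ l) = (W γ μ x).det * ∏ k : Fin L, b (x 0 - x k.succ) := by
  have hinj : Function.Injective x := fun i j hij => by
    by_contra h
    exact hx i j h (by simp [hij, b])
  have hne : ∀ k : Fin L, x 0 ≠ x k.succ := fun k => hinj.ne (Fin.succ_ne_zero k).symm
  rw [Z_mul_prod_eq_det (P := Set.range x) (t := x 0) (r := X x) (φ := fun _ => 1)
    (ψ := fun k => a γ (x k.succ - x 0) / b (x k.succ - x 0))]
  · congr 2
    ext α β
    rw [W_apply_eq μ hx hg]
    simp [partitionMatrix, cauchyPencil, diagCoeff, cauchyCoeff, X]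
  · rintro _ ⟨i, rfl⟩ _ ⟨j, rfl⟩
    exact hg i j
  · rintro _ ⟨i, rfl⟩ _ ⟨j, rfl⟩ hij
    exact hx i j fun h => hij (h ▸ rfl)
  · exact ⟨0, rfl⟩
  · exact fun k => ⟨k.succ, rfl⟩
  · exact hinj.comp (Fin.succ_injective _)
  · exact hinj.comp (Fin.succ_injective _)
  · exact hne
  · exact fun k => Or.inl ⟨rfl, rfl, rfl⟩

theorem Z_XReplace_of_generic (hx : ∀ i j : Fin (L + 1), i ≠ j → b (x i - x j) ≠ 0)
    (hg : ∀ i j, a γ (x i - x j) ≠ 0)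
    (i : Fin L) :
    Z γ μ (XReplace x i) * ∏ l, b (x 0 - μ l) =
      (WCol γ μ x i).det * ∏ k : Fin L, b (x 0 - x k.succ) := by
  have hinj : Function.Injective x := fun i j hij => by
    by_contra h
    exact hx i j h (by simp [hij, b])
  have hne : ∀ k : Fin L, x 0 ≠ x k.succ := fun k => hinj.ne (Fin.succ_ne_zero k).symm
  have hX : Function.Injective (X x) := hinj.comp (Fin.succ_injective _)
  have hi : XReplace x i i = x 0 := by simp [XReplace]
  have hk : ∀ k, k ≠ i → XReplace x i k = x k.succ := fun k hk => by simp [XReplace, hk, X]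
  rw [Z_mul_prod_eq_det (P := Set.range x) (t := x 0) (r := X x)
    (φ := fun k => if k = i then 0 else 1)
    -- For the replaced column, `ψ` supplies the factor that `cauchyCoeff` omits, with the sign that
    -- cancels the minus of the Cauchy part.
    (ψ := fun k => if k = i then -(a γ (x 0 - x k.succ) / b (x 0 - x k.succ))
      else a γ (x k.succ - x 0) / b (x k.succ - x 0))]
  · congr 2
    ext α β
    by_cases h : β = i
    · subst h
      simp only [partitionMatrix, cauchyPencil, diagCoeff, cauchyCoeff, if_true, zero_mul, ite_self,
        WCol, X, hi]
      -- Both sides are the full product over `k`, so the column does not depend on which factor was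
      -- singled out.
      have h1 : (a γ (x 0 - x β.succ) / b (x 0 - x β.succ)) *
          (∏ k, if k = β then 1 else a γ (x 0 - x k.succ) / b (x 0 - x k.succ)) =
          (a γ (x 0 - x α.succ) / b (x 0 - x α.succ)) *
            ∏ k ∈ Finset.univ.filter (fun k : Fin L => k ≠ α),
              a γ (x 0 - x k.succ) / b (x 0 - x k.succ) := by
        have h2 : ∀ (α : Fin L) (f : Fin L → ℂ),
            f α * ∏ k ∈ Finset.univ.filter (fun k => k ≠ α), f k = ∏ k, f k := fun α f => by
          rw [← Finset.mul_prod_erase _ _ (Finset.mem_univ α)]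
          congr 2
          ext k
          simp
        rw [h2 α fun k => a γ (x 0 - x k.succ) / b (x 0 - x k.succ),
          ← h2 β fun k => a γ (x 0 - x k.succ) / b (x 0 - x k.succ), Finset.prod_filter]
        simp only [ite_not, ne_eq]
      have e : c γ 0 / a γ (x 0 - x α.succ) * (-(a γ (x 0 - x β.succ) / b (x 0 - x β.succ)) *
          (∏ l, b (x 0 - μ l)) *
          ∏ k, if k = β then 1 else a γ (x 0 - x k.succ) / b (x 0 - x k.succ)) =
        -(c γ 0 / a γ (x 0 - x α.succ) * (∏ l, b (x 0 - μ l)) *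
          ((a γ (x 0 - x β.succ) / b (x 0 - x β.succ)) *
          (∏ k, if k = β then 1 else a γ (x 0 - x k.succ) / b (x 0 - x k.succ)))) := by ring
      have n1 := hg 0 α.succ
      have hc : c γ (x 0 - x α.succ) = c γ 0 := rfl
      rw [e, h1, hc]
      field_simp
      ring
    · simp only [WCol, if_neg h, W_apply_eq μ hx hg, partitionMatrix, cauchyPencil, diagCoeff,
        cauchyCoeff, hk β h, X, one_mul]
  · rintro _ ⟨i, rfl⟩ _ ⟨j, rfl⟩
    exact hg i j
  · rintro _ ⟨i, rfl⟩ _ ⟨j, rfl⟩ hij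
    exact hx i j fun h => hij (h ▸ rfl)
  · exact ⟨0, rfl⟩
  · exact fun k => ⟨k.succ, rfl⟩
  · exact hX
  · intro k l hkl
    by_cases h1 : k = i <;> by_cases h2 : l = i
    · rw [h1, h2]
    · rw [h1, hi, hk l h2] at hkl
      exact absurd hkl (hne l)
    · rw [h2, hi, hk k h1] at hkl
      exact absurd hkl.symm (hne k)
    · rw [hk k h1, hk l h2] at hkl
      exact hX hkl
  · exact hne
  · intro k
    by_cases h : k = i
    · subst h
      exact Or.inr ⟨hi, by simp, by simp [X]⟩
    · exact Or.inl ⟨hk k h, by simp [h], by simp [h, X]⟩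

end

section
variable {L : ℕ} (γ : ℂ) (μ : Fin L → ℂ) {x : Fin (L + 1) → ℂ}

/-- The denominators of `W` do not involve `γ`, so both sides are continuous in `γ` and the generic
case suffices. -/
theorem Z_X_mul_prod (hx : ∀ i j : Fin (L + 1), i ≠ j → b (x i - x j) ≠ 0) :
    Z γ μ (X x) * ∏ l, b (x 0 - μ l) = (W γ μ x).det * ∏ k : Fin L, b (x 0 - x k.succ) :=
  eq_of_generic (fun p : Fin (L + 1) × Fin (L + 1) => x p.1 - x p.2)
    ((continuous_Z (μ := fun _ => μ) continuous_const _).mul continuous_const)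
    ((continuous_det_W μ x).mul continuous_const)
    (fun _ h => Z_X_of_generic μ hx fun i j => h (i, j)) γ

theorem Z_XReplace_mul_prod (hx : ∀ i j : Fin (L + 1), i ≠ j → b (x i - x j) ≠ 0)
    (i : Fin L) :
    Z γ μ (XReplace x i) * ∏ l, b (x 0 - μ l) =
      (WCol γ μ x i).det * ∏ k : Fin L, b (x 0 - x k.succ) :=
  eq_of_generic (fun p : Fin (L + 1) × Fin (L + 1) => x p.1 - x p.2)
    ((continuous_Z (μ := fun _ => μ) continuous_const _).mul continuous_const)
    ((continuous_det_WCol μ x i).mul continuous_const)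
    (fun _ h => Z_XReplace_of_generic μ hx (fun i j => h (i, j)) i) γ

end

/-! ### Crossing from `W` to `V` -/

section
variable {L : ℕ} (γ : ℂ) (μ : Fin L → ℂ) (x : Fin (L + 1) → ℂ)

theorem a_crossing (u v : ℂ) : a γ (-u - (γ - v)) = -b (u - v) := by
  rw [a, b, ← Complex.sinh_neg]
  congr 1
  ring

theorem b_crossing (u v : ℂ) : b (-u - (γ - v)) = -a γ (u - v) := by
  rw [a, b, ← Complex.sinh_neg]
  congr 1
  ring

/-- Crossing exchanges the products of `a` and `b` over the inhomogeneities with one sign per site,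
and merely reverses the differences of the `x k`. -/
theorem V_eq_smul_W :
    V γ μ x = (-1 : ℂ) ^ L • W γ (fun l => γ - μ l) (fun k => -x k) := by
  have h5 : ((-1 : ℂ) ^ L) * (-1) ^ L = 1 := by rw [← mul_pow]; simp
  ext α β
  simp only [V, W, Matrix.smul_apply, smul_eq_mul, a_crossing, b_crossing, neg_sub_neg,
    Finset.prod_neg, Finset.card_univ, Fintype.card_fin]
  split_ifs
  · linear_combination (-(∏ k, b (x α.succ - μ k)) + (∏ k, a γ (x α.succ - μ k)) *
      ∏ k ∈ Finset.univ.filter (fun k => k ≠ α.succ),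
        a γ (x k - x α.succ) / b (x k - x α.succ)) * h5
  · linear_combination (-(c γ (x β.succ - x α.succ) / b (x β.succ - x α.succ) *
      (∏ k, a γ (x β.succ - μ k)) *
        ∏ k ∈ Finset.univ.filter (fun k => k ≠ α.succ ∧ k ≠ β.succ),
          a γ (x k - x β.succ) / b (x k - x β.succ))) * h5

theorem VCol_eq_smul_WCol (i : Fin L) :
    VCol γ μ x i = (-1 : ℂ) ^ L • WCol γ (fun l => γ - μ l) (fun k => -x k) i := by
  have h5 : ((-1 : ℂ) ^ L) * (-1) ^ L = 1 := by rw [← mul_pow]; simp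
  ext α β
  simp only [VCol, WCol, V_eq_smul_W, Matrix.smul_apply, smul_eq_mul, b_crossing, neg_sub_neg,
    Finset.prod_neg, Finset.card_univ, Fintype.card_fin]
  split_ifs
  · linear_combination (-(c γ (x α.succ - x 0) / b (x α.succ - x 0) *
      (∏ k, a γ (x 0 - μ k)) * ∏ k ∈ Finset.univ.filter (fun k : Fin L => k ≠ α),
          a γ (x k.succ - x 0) / b (x k.succ - x 0))) * h5
  · rfl

variable {x}

theorem b_neg_sub_neg_ne_zero (hx : ∀ i j : Fin (L + 1), i ≠ j → b (x i - x j) ≠ 0)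
    (i j : Fin (L + 1)) (h : i ≠ j) : b (-x i - -x j) ≠ 0 := by
  rw [neg_sub_neg]
  exact hx j i h.symm

theorem Z_X_mul_prod_crossed (hx : ∀ i j : Fin (L + 1), i ≠ j → b (x i - x j) ≠ 0) :
    Z γ μ (X x) * ∏ l, a γ (x 0 - μ l) = (V γ μ x).det * ∏ k : Fin L, b (x k.succ - x 0) := by
  have h := Z_X_mul_prod γ (fun l => γ - μ l) (b_neg_sub_neg_ne_zero hx)
  have hX : X (fun k => -x k) = fun k => -X x k := rfl
  rw [hX, Z_crossing γ μ (X x) fun i k hik => hx _ _ ((Fin.succ_injective _).ne hik)] at h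
  simp only [b_crossing, neg_sub_neg, Finset.prod_neg, Finset.card_univ, Fintype.card_fin] at h
  rw [V_eq_smul_W, Matrix.det_smul, Fintype.card_fin, mul_assoc, ← h]
  -- The determinant contributes the sign `(-1) ^ (L * L)` and the product over the inhomogeneities
  -- `(-1) ^ L`; `L * (L + 1)` is even.
  have h6 : ((-1 : ℂ) ^ L) ^ L * (-1) ^ L = 1 := by
    rw [← pow_succ, ← pow_mul, (Nat.even_mul_succ_self L).neg_one_pow]
  linear_combination (-(Z γ μ (X x) * ∏ l, a γ (x 0 - μ l))) * h6

theorem Z_XReplace_mul_prod_crossed (hx : ∀ i j : Fin (L + 1), i ≠ j → b (x i - x j) ≠ 0)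
    (i : Fin L) :
    Z γ μ (XReplace x i) * ∏ l, a γ (x 0 - μ l) =
      (VCol γ μ x i).det * ∏ k : Fin L, b (x k.succ - x 0) := by
  have h := Z_XReplace_mul_prod γ (fun l => γ - μ l) (b_neg_sub_neg_ne_zero hx) i
  have hX : XReplace (fun k => -x k) i = fun k => -XReplace x i k := by
    funext k
    by_cases hk : k = i
    · subst hk
      simp [XReplace]
    · simp [XReplace, hk, X]
  have hy : ∀ j k, j ≠ k → b (XReplace x i j - XReplace x i k) ≠ 0 := by
    intro j k hjk
    have h1 : ∀ k, XReplace x i k = x (if k = i then 0 else k.succ) := fun k => by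
      by_cases hk : k = i
      · subst hk
        simp [XReplace]
      · simp [XReplace, hk, X]
    rw [h1, h1]
    refine hx _ _ ?_
    split_ifs with h2 h3 h3
    · exact absurd (h2.trans h3.symm) hjk
    · exact (Fin.succ_ne_zero k).symm
    · exact Fin.succ_ne_zero j
    · exact (Fin.succ_injective _).ne hjk
  rw [hX, Z_crossing γ μ _ hy] at h
  simp only [b_crossing, neg_sub_neg, Finset.prod_neg, Finset.card_univ, Fintype.card_fin] at h
  rw [VCol_eq_smul_WCol, Matrix.det_smul, Fintype.card_fin, mul_assoc, ← h]
  have h6 : ((-1 : ℂ) ^ L) ^ L * (-1) ^ L = 1 := by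
    rw [← pow_succ, ← pow_mul, (Nat.even_mul_succ_self L).neg_one_pow]
  linear_combination (-(Z γ μ (XReplace x i) * ∏ l, a γ (x 0 - μ l))) * h6

end

end

end SixVertex

theorem theorem7 (L : ℕ) (γ : ℂ) (μ : Fin L → ℂ) (x : Fin (L + 1) → ℂ)
    (hx : ∀ i j : Fin (L + 1), i ≠ j → SixVertex.b (x i - x j) ≠ 0) :
    ((∀ k : Fin L, SixVertex.b (x 0 - μ k) ≠ 0) →
      SixVertex.Z γ μ (SixVertex.X x) =
          (SixVertex.W γ μ x).det *
            ∏ k : Fin L, SixVertex.b (x 0 - x k.succ) / SixVertex.b (x 0 - μ k) ∧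
      ∀ i : Fin L,
        SixVertex.Z γ μ (SixVertex.XReplace x i) =
          (SixVertex.WCol γ μ x i).det *
            ∏ k : Fin L, SixVertex.b (x 0 - x k.succ) / SixVertex.b (x 0 - μ k)) ∧
    ((∀ k : Fin L, SixVertex.a γ (x 0 - μ k) ≠ 0) →
      SixVertex.Z γ μ (SixVertex.X x) =
          (SixVertex.V γ μ x).det *
            ∏ k : Fin L, SixVertex.b (x k.succ - x 0) / SixVertex.a γ (x 0 - μ k) ∧
      ∀ i : Fin L,
        SixVertex.Z γ μ (SixVertex.XReplace x i) =
          (SixVertex.VCol γ μ x i).det *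
            ∏ k : Fin L, SixVertex.b (x k.succ - x 0) / SixVertex.a γ (x 0 - μ k)) := by
  have key : ∀ {z d : ℂ} {p q : Fin L → ℂ}, (∀ k, q k ≠ 0) →
      z * ∏ k, q k = d * ∏ k, p k → z = d * ∏ k, p k / q k := by
    intro z d p q hq h
    rw [Finset.prod_div_distrib, ← mul_div_assoc, ← h,
      mul_div_cancel_right₀ _ (Finset.prod_ne_zero_iff.2 fun k _ => hq k)]
  exact ⟨fun h => ⟨key h (SixVertex.Z_X_mul_prod γ μ hx),
      fun i => key h (SixVertex.Z_XReplace_mul_prod γ μ hx i)⟩,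
    fun h => ⟨key h (SixVertex.Z_X_mul_prod_crossed γ μ hx),
      fun i => key h (SixVertex.Z_XReplace_mul_prod_crossed γ μ hx i)⟩⟩
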